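/- Let $m\ge 2$, let $f_{i,i+1}>0$ and $f_{i+1,i}>0$ ($i=1,\dots,m-1$) and $\beta>0$ be real constants, $f_{1,0}:=f_{m,m+1}:=0$, and let $\mathsf F=(f_{ij})$ be the tridiagonal $m\times m$ matrix with these off-diagonal entries, with $f_{ii}:=-f_{i,i-1}-f_{i,i+1}$ and $f_{ij}:=0$ for $|i-j|>1$. The multi-layer quasi-geostrophic model is the system \[ q^i_t+\psi^i_xq^i_y-\psi^i_yq^i_x=0,\qquad q^i:=\psi^i_{xx}+\psi^i_{yy}+(\mathsf F\psi)^i+\beta y,\qquad i=1,\dots,m, \] for the unknown functions $\psi=(\psi^1,\dots,\psi^m)^{\mathsf T}$ of $(t,x,y)$; let $\mathfrak g$ be its maximal Lie invariance algebra. Let $a\in\mathbb R$ and $c=(c_1,\dots,c_m)^{\mathsf T}\in\operatorname{im}\mathsf F$, and let $\mathfrak s:=\langle\partial_t+a\partial_y+\sum_kc_k\partial_{\psi^k}\rangle\subset\mathfrak g$. The ansatz $\psi^i=v^i(z_1,z_2)+c_it+ax$ with $z_1=x$, $z_2=y-at$ reduces the model to the system \[ v^i_1w^i_2-v^i_2w^i_1+(\mathsf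 Fc)^i+a\beta=0,\qquad w^i:=v^i_{11}+v^i_{22}+(\mathsf Fv)^i+\beta z_2,\qquad i=1,\dots,m, \] where the subscripts $1$ and $2$ denote derivatives with respect to $z_1$ and $z_2$. Then, for all such values of the parameters, the maximal Lie invariance algebra of this reduced system is the linear span \[\langle\partial_{z_1},\partial_{z_2},\partial_{v^1},\dots,\partial_{v^m}\rangle,\] and it is entirely induced by $\mathfrak g$: it coincides with the algebra of the vector fields that the elements of the normalizer $\mathrm N_{\mathfrak g}(\mathfrak s)$ induce in the space of the invariant variables $(z_1,z_2,v^1,\dots,v^m)$. Here the maximal Lie invariance algebra of a system consists of all smooth vector fields in the space of its independent and dependent variables (over a connected open set $U$ of this space for the reduced system, and over the preimage of $U$ under $(t,x,y,\psi)\mapsto(z,v)$ for the model) whose prolongations annihilate the left-hand sides of the equations at all jets that satisfy the system. -/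

import Mathlib

open scoped ContDiff

noncomputable section

namespace QG

/-! ### Jets, total derivatives and prolongations

There are `n` independent variables `x` and `m` dependent variables `u`. -/

/-- The space of independent and dependent variables `(x, u)`. -/
abbrev Base (n m : ℕ) : Type := (Fin n → ℝ) × (Fin m → ℝ)

/-- A vector field `∑ ξ^μ(x,u) ∂_{x_μ} + ∑ η^j(x,u) ∂_{u^j}`, as the map `(x, u) ↦ (ξ, η)`. -/
abbrev VectorFieldOn (n m : ℕ) : Type := Base n m → Base n m

/-- The (infinite-order) jet space: the coordinates are the `x_μ` and the `u^j_α`, with `α` a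
multi-index.  The same type also serves for its tangent vectors. -/
abbrev Jet (n m : ℕ) : Type := (Fin n → ℝ) × (Fin m → (Fin n → ℕ) → ℝ)

/-- The multi-index `e_μ`. -/
abbrev unitIndex {n : ℕ} (μ : Fin n) : Fin n → ℕ := Pi.single μ 1

/-- The projection of a jet to its `(x, u)` part. -/
def base {n m : ℕ} (p : Jet n m) : Base n m := (p.1, fun j => p.2 j 0)

/-- The total derivative `D_μ = ∂_{x_μ} + ∑_{j,α} u^j_{α + e_μ} ∂_{u^j_α}`: the derivative along the
vector field on the jet space whose `x`-part is `e_μ` and whose `u^j_α`-part is `u^j_{α + e_μ}`. -/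
def totalDeriv {n m : ℕ} (μ : Fin n) (A : Jet n m → ℝ) : Jet n m → ℝ := fun p =>
  lineDeriv ℝ A p (Pi.single μ 1, fun j α => p.2 j (α + unitIndex μ))

/-- The iterated total derivative `D^α = D_0^{α_0} ⋯ D_{n-1}^{α_{n-1}}`. -/
def totalDerivs {n m : ℕ} (α : Fin n → ℕ) (A : Jet n m → ℝ) : Jet n m → ℝ :=
  (List.finRange n).foldr (fun μ B => (totalDeriv μ)^[α μ] B) A

/-- The characteristic `Q[u]^j = η^j - ∑_μ ξ^μ u^j_μ` of a vector field. -/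
def characteristic {n m : ℕ} (Q : VectorFieldOn n m) (j : Fin m) : Jet n m → ℝ := fun p =>
  (Q (base p)).2 j - ∑ μ, (Q (base p)).1 μ * p.2 j (unitIndex μ)

/-- The prolongation of a vector field to the jet space, with components `ξ^μ` and
`η^{j,α} = D^α (η^j - ∑_μ ξ^μ u^j_μ) + ∑_μ ξ^μ u^j_{α + e_μ}`. -/
def prolongation {n m : ℕ} (Q : VectorFieldOn n m) (p : Jet n m) : Jet n m :=
  ((Q (base p)).1, fun j α =>
    totalDerivs α (characteristic Q j) p + ∑ μ, (Q (base p)).1 μ * p.2 j (α + unitIndex μ))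

/-- The maximal Lie invariance algebra, on the open set `U` of the space of the variables `(x, u)`,
of the system of differential equations `E^i = 0`: all vector fields that are smooth on `U` and
satisfy the infinitesimal invariance criterion, i.e. the prolonged field annihilates each `E^i` at
each jet over `U` that satisfies the system.  Only the values on `U` of the vector field matter. -/
def maxLieInvarianceAlgebra {n m : ℕ} {ι : Type} (E : ι → Jet n m → ℝ) (U : Set (Base n m)) :
    Set (VectorFieldOn n m) :=
  {Q | ContDiffOn ℝ ∞ Q U ∧
    ∀ p : Jet n m, base p ∈ U → (∀ i, E i p = 0) →
      ∀ i, lineDeriv ℝ (E i) p (prolongation Q p) = 0}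

/-- The normalizer, in a set `g` of vector fields on `U`, of a space `s` of vector fields. -/
def normalizer {n m : ℕ} (g : Set (VectorFieldOn n m)) (s : Submodule ℝ (VectorFieldOn n m))
    (U : Set (Base n m)) : Set (VectorFieldOn n m) :=
  {Q | Q ∈ g ∧ ∀ S ∈ s, ∃ S' ∈ s, Set.EqOn (VectorField.lieBracket ℝ Q S) S' U}

/-- The vector field `∂_{x_μ}`. -/
def partialX {n m : ℕ} (μ : Fin n) : VectorFieldOn n m := fun _ => (Pi.single μ 1, 0)

/-- The vector field `∂_{u^j}`. -/
def partialU {n m : ℕ} (j : Fin m) : VectorFieldOn n m := fun _ => (0, Pi.single j 1)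

/-- The Poisson bracket (Jacobian) `D_μ A D_ν B - D_ν A D_μ B`. -/
def poisson {n m : ℕ} (μ ν : Fin n) (A B : Jet n m → ℝ) : Jet n m → ℝ := fun p =>
  totalDeriv μ A p * totalDeriv ν B p - totalDeriv ν A p * totalDeriv μ B p

/-! ### The multi-layer quasi-geostrophic model and its reduction -/

/-- Neighbouring layers. -/
abbrev Adjacent {m : ℕ} (i j : Fin m) : Prop := i.val + 1 = j.val ∨ j.val + 1 = i.val

/-- The vertical coupling matrix: tridiagonal, with zero row sums and with the entries `f i j` for
neighbouring layers `i`, `j` (the other values of `f` are not used). -/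
def couplingMatrix {m : ℕ} (f : Fin m → Fin m → ℝ) : Matrix (Fin m) (Fin m) ℝ :=
  Matrix.of fun i j =>
    if Adjacent i j then f i j
    else if i = j then -∑ k, (if Adjacent i k then f i k else 0)
    else 0

/-- The potential vorticity `q^i = ψ^i_{xx} + ψ^i_{yy} + (F ψ)^i + β y`; the independent variables
are `(t, x, y)`, numbered `0, 1, 2`. -/
def vorticity {m : ℕ} (F : Matrix (Fin m) (Fin m) ℝ) (β : ℝ) (i : Fin m) : Jet 3 m → ℝ := fun p =>
  p.2 i ![0, 2, 0] + p.2 i ![0, 0, 2] + (F.mulVec fun j => p.2 j 0) i + β * p.1 2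

/-- The left-hand sides of the multi-layer model `q^i_t + {ψ^i, q^i} = 0`. -/
def model {m : ℕ} (F : Matrix (Fin m) (Fin m) ℝ) (β : ℝ) (i : Fin m) : Jet 3 m → ℝ := fun p =>
  totalDeriv 0 (vorticity F β i) p + poisson 1 2 (fun p => p.2 i 0) (vorticity F β i) p

/-- The basis element `∂_t + a ∂_y + ∑_k c_k ∂_{ψ^k}` of the reduction subalgebra. -/
def generator {m : ℕ} (a : ℝ) (c : Fin m → ℝ) : VectorFieldOn 3 m :=
  partialX 0 + a • partialX 2 + ∑ k, c k • partialU k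

/-- The invariants `z_1 = x`, `z_2 = y - a t`, `v^i = ψ^i - c_i t - a x` of the subalgebra spanned
by `generator a c`, as a map `(t, x, y, ψ) ↦ (z, v)`; the ansatz is `ψ^i = v^i(z) + c_i t + a x`. -/
def invariants {m : ℕ} (a : ℝ) (c : Fin m → ℝ) : Base 3 m → Base 2 m := fun P =>
  (![P.1 1, P.1 2 - a * P.1 0], fun i => P.2 i - c i * P.1 0 - a * P.1 1)

/-- `w^i = v^i_{11} + v^i_{22} + (F v)^i + β z_2`. -/
def reducedVorticity {m : ℕ} (F : Matrix (Fin m) (Fin m) ℝ) (β : ℝ) (i : Fin m) :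
    Jet 2 m → ℝ := fun p =>
  p.2 i ![2, 0] + p.2 i ![0, 2] + (F.mulVec fun j => p.2 j 0) i + β * p.1 1

/-- The left-hand sides of the reduced system `{v^i, w^i} + (F c)^i + a β = 0`. -/
def reducedSystem {m : ℕ} (F : Matrix (Fin m) (Fin m) ℝ) (β a : ℝ) (c : Fin m → ℝ) (i : Fin m) :
    Jet 2 m → ℝ := fun p =>
  poisson 0 1 (fun p => p.2 i 0) (reducedVorticity F β i) p + F.mulVec c i + a * β

/-- The vector fields on `U`, in the space of the variables `(z, v)`, that are induced by the
maximal Lie invariance algebra `g` of the model: the images under the invariants of the elements of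
the normalizer in `g` of the reduction subalgebra. -/
def inducedAlgebra {m : ℕ} (F : Matrix (Fin m) (Fin m) ℝ) (β a : ℝ) (c : Fin m → ℝ)
    (U : Set (Base 2 m)) : Set (VectorFieldOn 2 m) :=
  {R | ∃ Q ∈ normalizer (maxLieInvarianceAlgebra (model F β) (invariants a c ⁻¹' U))
        (Submodule.span ℝ {generator a c}) (invariants a c ⁻¹' U),
      ∀ P ∈ invariants a c ⁻¹' U, fderiv ℝ (invariants a c) P (Q P) = R (invariants a c P)}

end QG

end

/-! The infinitesimal criterion is polynomial in the derivatives of `v`, so evaluating it at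
suitable jets of the reduced system yields determining equations. The system contains no
second-order derivatives, and jets in which these vanish (`thirdJet`) turn out to suffice.
Subtracting the criteria at two such jets with equal gradients isolates the part linear in the
third-order derivatives (`criterion_third_order`). Perturbing only layer `j` and reading equation `i
≠ j` shows that `η^i` and `ξ` do not depend on `v^j` (`fderiv_other_layer`); as there are at least
two layers, `ξ` depends on `z` alone. Equal data in all layers show that `ξ` is conformal and that
`η^i` does not depend on `z` (`fderiv_conformal`).

Let `θ` and `ρ` be the dilation and rotation rates of `ξ`, and `h_i` the derivative of `η^i` in
`v^i`. What remains of the criterion (`criterion_first_order`) compares weights: `{v^i, Δv^i}` has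
weight `2h_i - 4θ`, the `β`-term `h_i - θ`, and the coupling of layers `i` and `j` has `h_i + h_j -
2θ`. The `β`-term breaks rotations, so `ρ = 0` and `h_i = 3θ`; coupling gives `h_j = h_i - 2θ`.
Hence all rates vanish, the field has zero derivative (`fderiv_eq_zero_of_mem`), and it is constant
since `U` is connected.

Conversely, constant fields are symmetries, because the equations involve only derivatives of the
unknowns and no explicit independent variables. Each lifts to a constant symmetry of the model
commuting with the generator (`const_mem_inducedAlgebra`). That induced fields are symmetries is
proved without computing the algebra of the model: the ansatz gives an affine map of jets which
carries the reduced system to the model and intertwines the total derivatives and prolongations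
(`induced_mem_reducedSystem`). -/

noncomputable section

namespace QG

/-! ### Calculus of total derivatives on jets. -/

section
variable {n m : ℕ} {W W' : Type*} [NormedAddCommGroup W] [NormedSpace ℝ W]
  [NormedAddCommGroup W'] [NormedSpace ℝ W'] {U : Set (Base n m)}

/-- The total derivative `D_μ` as a tangent vector of the jet space. -/
def totalVec (μ : Fin n) (p : Jet n m) : Jet n m :=
  (Pi.single μ 1, fun j α => p.2 j (α + unitIndex μ))

/-- The projection of the total derivative `D_μ` to the space of the variables `(x, u)`. -/
def tangent (μ : Fin n) (p : Jet n m) : Base n m :=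
  (Pi.single μ 1, fun j => p.2 j (unitIndex μ))

/-- The vertical vector with the components `u^j_α`. -/
def vertical (α : Fin n → ℕ) (p : Jet n m) : Base n m := (0, fun j => p.2 j α)

theorem base_totalVec (μ : Fin n) (p : Jet n m) : base (totalVec μ p) = tangent μ p := by
  simp [base, totalVec, tangent]

/-- A line through a jet over an open set of the space of the variables `(x, u)` stays over this set
for small times. -/
theorem eventually_base_mem (hU : IsOpen U) {p : Jet n m} (hp : base p ∈ U) (V : Jet n m) :
    ∀ᶠ t : ℝ in nhds 0, base (p + t • V) ∈ U := by
  have hc : Continuous fun t : ℝ => base p + t • base V := by fun_prop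
  refine hc.continuousAt.eventually_mem (hU.mem_nhds ?_)
  simpa using hp

/-- Over `U`, the total derivative `D_μ A` exists and equals `B`. -/
def HasTotalDeriv (U : Set (Base n m)) (μ : Fin n) (A B : Jet n m → W) : Prop :=
  ∀ p, base p ∈ U → HasLineDerivAt ℝ A (B p) p (totalVec μ p)

theorem HasTotalDeriv.totalDeriv_eq {μ : Fin n} {A B : Jet n m → ℝ} (h : HasTotalDeriv U μ A B)
    {p : Jet n m} (hp : base p ∈ U) : totalDeriv μ A p = B p :=
  (h p hp).lineDeriv

theorem HasTotalDeriv.congr (hU : IsOpen U) {μ : Fin n} {A A' B : Jet n m → W}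
    (h : HasTotalDeriv U μ A B) (hA : ∀ p, base p ∈ U → A' p = A p) : HasTotalDeriv U μ A' B :=
  fun p hp => HasDerivAt.congr_of_eventuallyEq (h p hp)
    ((eventually_base_mem hU hp _).mono fun _ ht => hA _ ht)

theorem totalDeriv_congr (hU : IsOpen U) {μ : Fin n} {A A' : Jet n m → ℝ}
    (hA : ∀ p, base p ∈ U → A p = A' p) {p : Jet n m} (hp : base p ∈ U) :
    totalDeriv μ A p = totalDeriv μ A' p :=
  Filter.EventuallyEq.deriv_eq ((eventually_base_mem hU hp _).mono fun _ ht => hA _ ht)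

theorem HasTotalDeriv.add {μ : Fin n} {A B A' B' : Jet n m → W} (h : HasTotalDeriv U μ A B)
    (h' : HasTotalDeriv U μ A' B') :
    HasTotalDeriv U μ (fun p => A p + A' p) (fun p => B p + B' p) :=
  fun p hp => HasDerivAt.add (h p hp) (h' p hp)

theorem HasTotalDeriv.sub {μ : Fin n} {A B A' B' : Jet n m → W} (h : HasTotalDeriv U μ A B)
    (h' : HasTotalDeriv U μ A' B') :
    HasTotalDeriv U μ (fun p => A p - A' p) (fun p => B p - B' p) :=
  fun p hp => HasDerivAt.sub (h p hp) (h' p hp)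

theorem HasTotalDeriv.sum {ι : Type*} (s : Finset ι) {μ : Fin n} {A B : ι → Jet n m → W}
    (h : ∀ i ∈ s, HasTotalDeriv U μ (A i) (B i)) :
    HasTotalDeriv U μ (fun p => ∑ i ∈ s, A i p) (fun p => ∑ i ∈ s, B i p) :=
  fun p hp => HasDerivAt.fun_sum fun i hi => h i hi p hp

theorem HasTotalDeriv.mul {μ : Fin n} {A B A' B' : Jet n m → ℝ} (h : HasTotalDeriv U μ A B)
    (h' : HasTotalDeriv U μ A' B') :
    HasTotalDeriv U μ (fun p => A p * A' p) (fun p => B p * A' p + A p * B' p) := by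
  intro p hp
  have := HasDerivAt.mul (h p hp) (h' p hp)
  simp only [zero_smul, add_zero] at this
  exact this

theorem HasTotalDeriv.clm_apply {μ : Fin n} {A B : Jet n m → W →L[ℝ] W'} {A' B' : Jet n m → W}
    (h : HasTotalDeriv U μ A B) (h' : HasTotalDeriv U μ A' B') :
    HasTotalDeriv U μ (fun p => A p (A' p)) (fun p => B p (A' p) + A p (B' p)) := by
  intro p hp
  have := HasDerivAt.clm_apply (h p hp) (h' p hp)
  simp only [zero_smul, add_zero] at this
  exact this

theorem hasTotalDeriv_coord (μ : Fin n) (j : Fin m) (α : Fin n → ℕ) :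
    HasTotalDeriv U μ (fun p => p.2 j α) (fun p => p.2 j (α + unitIndex μ)) := by
  intro p _
  have := ((hasDerivAt_id (0 : ℝ)).mul_const (p.2 j (α + unitIndex μ))).const_add (p.2 j α)
  simpa [HasLineDerivAt, totalVec] using this

theorem hasTotalDeriv_vertical (μ : Fin n) (α : Fin n → ℕ) :
    HasTotalDeriv U μ (vertical (m := m) α) (vertical (α + unitIndex μ)) := by
  intro p hp
  exact HasDerivAt.prodMk (hasDerivAt_const _ _)
    (hasDerivAt_pi.2 fun j => hasTotalDeriv_coord μ j α p hp)

theorem hasTotalDeriv_tangent (ν μ : Fin n) :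
    HasTotalDeriv U ν (tangent (m := m) μ) (vertical (unitIndex μ + unitIndex ν)) := by
  intro p hp
  exact HasDerivAt.prodMk (hasDerivAt_const _ _)
    (hasDerivAt_pi.2 fun j => hasTotalDeriv_coord ν j (unitIndex μ) p hp)

/-- A line of jets projects to a line in the finite-dimensional base, so the ordinary chain rule
links line derivatives on jets with `fderiv`. -/
theorem hasTotalDeriv_comp_base {G : Base n m → W} (hG : ∀ b ∈ U, DifferentiableAt ℝ G b)
    (μ : Fin n) :
    HasTotalDeriv U μ (fun p => G (base p)) (fun p => fderiv ℝ G (base p) (tangent μ p)) := by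
  intro p hp
  have h1 : HasDerivAt (fun t : ℝ => base p + t • base (totalVec μ p)) (tangent μ p) 0 := by
    rw [base_totalVec]
    simpa using ((hasDerivAt_id (0 : ℝ)).smul_const (tangent μ p)).const_add (base p)
  have h2 : HasFDerivAt G (fderiv ℝ G (base p)) (base p + (0 : ℝ) • base (totalVec μ p)) := by
    simpa using (hG _ hp).hasFDerivAt
  exact h2.comp_hasDerivAt (0 : ℝ) h1

/-! ### Total derivatives of functions of `(x, u)` -/

/-- The first total derivative of `g(x, u)`. -/
def total₁ (g : Base n m → ℝ) (μ : Fin n) (p : Jet n m) : ℝ :=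
  fderiv ℝ g (base p) (tangent μ p)

/-- The second total derivative `D_ν D_μ g` of `g(x, u)`. -/
def total₂ (g : Base n m → ℝ) (ν μ : Fin n) (p : Jet n m) : ℝ :=
  fderiv ℝ (fderiv ℝ g) (base p) (tangent ν p) (tangent μ p) +
    fderiv ℝ g (base p) (vertical (unitIndex μ + unitIndex ν) p)

/-- The third total derivative `D_κ D_ν D_μ g` of `g(x, u)`. -/
def total₃ (g : Base n m → ℝ) (κ ν μ : Fin n) (p : Jet n m) : ℝ :=
  fderiv ℝ (fderiv ℝ (fderiv ℝ g)) (base p) (tangent κ p) (tangent ν p) (tangent μ p) +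
    fderiv ℝ (fderiv ℝ g) (base p) (vertical (unitIndex ν + unitIndex κ) p) (tangent μ p) +
    fderiv ℝ (fderiv ℝ g) (base p) (tangent ν p) (vertical (unitIndex μ + unitIndex κ) p) +
    (fderiv ℝ (fderiv ℝ g) (base p) (tangent κ p) (vertical (unitIndex μ + unitIndex ν) p) +
      fderiv ℝ g (base p) (vertical (unitIndex μ + unitIndex ν + unitIndex κ) p))

theorem contDiffOn_fderiv (hU : IsOpen U) {G : Base n m → W} (hG : ContDiffOn ℝ ∞ G U) :
    ContDiffOn ℝ ∞ (fderiv ℝ G) U :=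
  hG.fderiv_of_isOpen hU (by simp)

theorem differentiableAt_of_contDiffOn (hU : IsOpen U) {G : Base n m → W}
    (hG : ContDiffOn ℝ ∞ G U) : ∀ b ∈ U, DifferentiableAt ℝ G b := fun b hb =>
  (hG.contDiffAt (hU.mem_nhds hb)).differentiableAt (by simp)

variable {g : Base n m → ℝ}

theorem hasTotalDeriv_base (hU : IsOpen U) (hg : ContDiffOn ℝ ∞ g U) (μ : Fin n) :
    HasTotalDeriv U μ (fun p => g (base p)) (total₁ g μ) :=
  hasTotalDeriv_comp_base (differentiableAt_of_contDiffOn hU hg) μ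

theorem hasTotalDeriv_total₁ (hU : IsOpen U) (hg : ContDiffOn ℝ ∞ g U) (ν μ : Fin n) :
    HasTotalDeriv U ν (total₁ g μ) (total₂ g ν μ) :=
  (hasTotalDeriv_comp_base (differentiableAt_of_contDiffOn hU (contDiffOn_fderiv hU hg)) ν).clm_apply
    (hasTotalDeriv_tangent ν μ)

theorem hasTotalDeriv_total₂ (hU : IsOpen U) (hg : ContDiffOn ℝ ∞ g U) (κ ν μ : Fin n) :
    HasTotalDeriv U κ (total₂ g ν μ) (total₃ g κ ν μ) := by
  have h1 := hasTotalDeriv_comp_base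
    (differentiableAt_of_contDiffOn hU (contDiffOn_fderiv hU hg)) κ
  have h2 := hasTotalDeriv_comp_base
    (differentiableAt_of_contDiffOn hU (contDiffOn_fderiv hU (contDiffOn_fderiv hU hg))) κ
  exact ((h2.clm_apply (hasTotalDeriv_tangent κ ν)).clm_apply (hasTotalDeriv_tangent κ μ)).add
    (h1.clm_apply (hasTotalDeriv_vertical κ (unitIndex μ + unitIndex ν)))

theorem fderiv_fderiv_symm (hU : IsOpen U) {G : Base n m → W} (hG : ContDiffOn ℝ ∞ G U)
    {b : Base n m} (hb : b ∈ U) (x y : Base n m) :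
    fderiv ℝ (fderiv ℝ G) b x y = fderiv ℝ (fderiv ℝ G) b y x :=
  ((hG.contDiffAt (hU.mem_nhds hb)).isSymmSndFDerivAt
    (by simpa using WithTop.coe_le_coe.2 (le_top : (2 : ℕ∞) ≤ ⊤))) x y

theorem total₂_symm (hU : IsOpen U) (hg : ContDiffOn ℝ ∞ g U) (ν μ : Fin n) {p : Jet n m}
    (hp : base p ∈ U) : total₂ g ν μ p = total₂ g μ ν p := by
  simp only [total₂]
  rw [fderiv_fderiv_symm hU hg hp (tangent ν p), add_comm (unitIndex μ)]

theorem total₃_symm (hU : IsOpen U) (hg : ContDiffOn ℝ ∞ g U) (κ ν μ : Fin n) {p : Jet n m}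
    (hp : base p ∈ U) : total₃ g κ ν μ p = total₃ g ν κ μ p := by
  simp only [total₃]
  rw [fderiv_fderiv_symm hU (contDiffOn_fderiv hU hg) hp (tangent κ p), add_comm (unitIndex ν),
    add_right_comm (unitIndex μ) (unitIndex ν)]
  ring

/-! ### Total derivatives of the characteristic -/

variable {Q : VectorFieldOn n m}

/-- The component `ξ^μ`. -/
def xiComp (Q : VectorFieldOn n m) (μ : Fin n) : Base n m → ℝ := fun b => (Q b).1 μ

/-- The component `η^j`. -/
def etaComp (Q : VectorFieldOn n m) (j : Fin m) : Base n m → ℝ := fun b => (Q b).2 j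

theorem contDiffOn_xiComp (hQ : ContDiffOn ℝ ∞ Q U) (μ : Fin n) :
    ContDiffOn ℝ ∞ (xiComp Q μ) U := by
  exact contDiffOn_pi.1 (contDiff_fst.comp_contDiffOn hQ) μ

theorem contDiffOn_etaComp (hQ : ContDiffOn ℝ ∞ Q U) (j : Fin m) :
    ContDiffOn ℝ ∞ (etaComp Q j) U := by
  exact contDiffOn_pi.1 (contDiff_snd.comp_contDiffOn hQ) j

theorem hasTotalDeriv_characteristic (hU : IsOpen U) (hQ : ContDiffOn ℝ ∞ Q U) (j : Fin m)
    (μ : Fin n) :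
    HasTotalDeriv U μ (characteristic Q j) (fun p => total₁ (etaComp Q j) μ p -
      ∑ l, (total₁ (xiComp Q l) μ p * p.2 j (unitIndex l) +
        xiComp Q l (base p) * p.2 j (unitIndex l + unitIndex μ))) :=
  (hasTotalDeriv_base hU (contDiffOn_etaComp hQ j) μ).sub <| HasTotalDeriv.sum _ fun l _ =>
    (hasTotalDeriv_base hU (contDiffOn_xiComp hQ l) μ).mul (hasTotalDeriv_coord μ j _)

theorem hasTotalDeriv_totalDeriv_characteristic (hU : IsOpen U) (hQ : ContDiffOn ℝ ∞ Q U)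
    (j : Fin m) (ν μ : Fin n) :
    HasTotalDeriv U ν (totalDeriv μ (characteristic Q j)) (fun p => total₂ (etaComp Q j) ν μ p -
      ∑ l, (total₂ (xiComp Q l) ν μ p * p.2 j (unitIndex l) +
        total₁ (xiComp Q l) μ p * p.2 j (unitIndex l + unitIndex ν) +
        (total₁ (xiComp Q l) ν p * p.2 j (unitIndex l + unitIndex μ) +
        xiComp Q l (base p) * p.2 j (unitIndex l + unitIndex μ + unitIndex ν)))) := by
  refine HasTotalDeriv.congr hU ?_
    fun p hp => (hasTotalDeriv_characteristic hU hQ j μ).totalDeriv_eq hp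
  refine (hasTotalDeriv_total₁ hU (contDiffOn_etaComp hQ j) ν μ).sub <|
    HasTotalDeriv.sum _ fun l _ => HasTotalDeriv.add ?_ ?_
  · exact (hasTotalDeriv_total₁ hU (contDiffOn_xiComp hQ l) ν μ).mul (hasTotalDeriv_coord ν j _)
  · exact (hasTotalDeriv_base hU (contDiffOn_xiComp hQ l) ν).mul (hasTotalDeriv_coord ν j _)

theorem hasTotalDeriv_totalDeriv_totalDeriv_characteristic (hU : IsOpen U)
    (hQ : ContDiffOn ℝ ∞ Q U) (j : Fin m) (κ ν μ : Fin n) :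
    HasTotalDeriv U κ (totalDeriv ν (totalDeriv μ (characteristic Q j)))
      (fun p => total₃ (etaComp Q j) κ ν μ p -
      ∑ l, (total₃ (xiComp Q l) κ ν μ p * p.2 j (unitIndex l) +
          total₂ (xiComp Q l) ν μ p * p.2 j (unitIndex l + unitIndex κ) +
        (total₂ (xiComp Q l) κ μ p * p.2 j (unitIndex l + unitIndex ν) +
          total₁ (xiComp Q l) μ p * p.2 j (unitIndex l + unitIndex ν + unitIndex κ)) +
        (total₂ (xiComp Q l) κ ν p * p.2 j (unitIndex l + unitIndex μ) +
          total₁ (xiComp Q l) ν p * p.2 j (unitIndex l + unitIndex μ + unitIndex κ) +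
        (total₁ (xiComp Q l) κ p * p.2 j (unitIndex l + unitIndex μ + unitIndex ν) +
          xiComp Q l (base p) *
            p.2 j (unitIndex l + unitIndex μ + unitIndex ν + unitIndex κ))))) := by
  refine HasTotalDeriv.congr hU ?_
    fun p hp => (hasTotalDeriv_totalDeriv_characteristic hU hQ j ν μ).totalDeriv_eq hp
  have hx l := contDiffOn_xiComp hQ l
  refine (hasTotalDeriv_total₂ hU (contDiffOn_etaComp hQ j) κ ν μ).sub <|
    HasTotalDeriv.sum _ fun l _ => ((HasTotalDeriv.mul ?_ ?_).add (HasTotalDeriv.mul ?_ ?_)).add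
      ((HasTotalDeriv.mul ?_ ?_).add (HasTotalDeriv.mul ?_ ?_))
  · exact hasTotalDeriv_total₂ hU (hx l) κ ν μ
  · exact hasTotalDeriv_coord κ j _
  · exact hasTotalDeriv_total₁ hU (hx l) κ μ
  · exact hasTotalDeriv_coord κ j _
  · exact hasTotalDeriv_total₁ hU (hx l) κ ν
  · exact hasTotalDeriv_coord κ j _
  · exact hasTotalDeriv_base hU (hx l) κ
  · exact hasTotalDeriv_coord κ j _

theorem totalDeriv_comm (hU : IsOpen U) (hQ : ContDiffOn ℝ ∞ Q U) (j : Fin m) (ν μ : Fin n)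
    {p : Jet n m} (hp : base p ∈ U) :
    totalDeriv ν (totalDeriv μ (characteristic Q j)) p =
      totalDeriv μ (totalDeriv ν (characteristic Q j)) p := by
  rw [(hasTotalDeriv_totalDeriv_characteristic hU hQ j ν μ).totalDeriv_eq hp,
    (hasTotalDeriv_totalDeriv_characteristic hU hQ j μ ν).totalDeriv_eq hp,
    total₂_symm hU (contDiffOn_etaComp hQ j) ν μ hp]
  congr 1
  refine Finset.sum_congr rfl fun l _ => ?_
  rw [total₂_symm hU (contDiffOn_xiComp hQ l) ν μ hp, add_right_comm (unitIndex l) (unitIndex μ)]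
  ring

/-- The total derivatives commute on third order total derivatives of a characteristic. -/
theorem totalDeriv_rotate (hU : IsOpen U) (hQ : ContDiffOn ℝ ∞ Q U) (j : Fin m) (ν μ : Fin n)
    {p : Jet n m} (hp : base p ∈ U) :
    totalDeriv ν (totalDeriv μ (totalDeriv μ (characteristic Q j))) p =
      totalDeriv μ (totalDeriv μ (totalDeriv ν (characteristic Q j))) p := by
  rw [totalDeriv_congr (μ := μ) hU (fun p hp => totalDeriv_comm hU hQ j μ ν hp) hp,
    (hasTotalDeriv_totalDeriv_totalDeriv_characteristic hU hQ j ν μ μ).totalDeriv_eq hp,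
    (hasTotalDeriv_totalDeriv_totalDeriv_characteristic hU hQ j μ ν μ).totalDeriv_eq hp,
    total₃_symm hU (contDiffOn_etaComp hQ j) ν μ μ hp]
  congr 1
  refine Finset.sum_congr rfl fun l _ => ?_
  rw [total₃_symm hU (contDiffOn_xiComp hQ l) ν μ μ hp,
    total₂_symm hU (contDiffOn_xiComp hQ l) ν μ hp,
    add_right_comm (unitIndex l) (unitIndex μ) (unitIndex ν),
    add_right_comm (unitIndex l + unitIndex μ) (unitIndex μ) (unitIndex ν),
    add_right_comm (unitIndex l) (unitIndex μ) (unitIndex ν)]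
  ring

/-! ### Prolongation coefficients of orders one and three. -/

/-- The component `η^{j,μ}` of the prolongation. -/
def prolong₁ (Q : VectorFieldOn n m) (j : Fin m) (μ : Fin n) (p : Jet n m) : ℝ :=
  total₁ (etaComp Q j) μ p - ∑ l, total₁ (xiComp Q l) μ p * p.2 j (unitIndex l)

/-- The component `η^{j,κνμ}` of the prolongation. -/
def prolong₃ (Q : VectorFieldOn n m) (j : Fin m) (κ ν μ : Fin n) (p : Jet n m) : ℝ :=
  total₃ (etaComp Q j) κ ν μ p -
    ∑ l, (total₃ (xiComp Q l) κ ν μ p * p.2 j (unitIndex l) +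
      total₂ (xiComp Q l) ν μ p * p.2 j (unitIndex l + unitIndex κ) +
      total₂ (xiComp Q l) κ μ p * p.2 j (unitIndex l + unitIndex ν) +
      total₂ (xiComp Q l) κ ν p * p.2 j (unitIndex l + unitIndex μ) +
      total₁ (xiComp Q l) μ p * p.2 j (unitIndex l + unitIndex ν + unitIndex κ) +
      total₁ (xiComp Q l) ν p * p.2 j (unitIndex l + unitIndex μ + unitIndex κ) +
      total₁ (xiComp Q l) κ p * p.2 j (unitIndex l + unitIndex μ + unitIndex ν))

/-- The second-order terms `ξ^l u_{l μ}` of the differentiated characteristic cancel against the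
correction in `prolongation`. The hypothesis on `totalDerivs` is definitional for a concrete
multi-index. -/
theorem prolongation_of_totalDerivs_eq₁ (hU : IsOpen U) (hQ : ContDiffOn ℝ ∞ Q U) {j : Fin m}
    {μ : Fin n} {α : Fin n → ℕ} (hα : α = unitIndex μ)
    (h : ∀ A : Jet n m → ℝ, totalDerivs α A = totalDeriv μ A) {p : Jet n m} (hp : base p ∈ U) :
    (prolongation Q p).2 j α = prolong₁ Q j μ p := by
  simp only [prolongation, h]
  rw [(hasTotalDeriv_characteristic hU hQ j μ).totalDeriv_eq hp, prolong₁, sub_add,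
    ← Finset.sum_sub_distrib]
  congr 1
  refine Finset.sum_congr rfl fun l _ => ?_
  rw [xiComp, hα, add_comm (unitIndex μ)]
  ring

/-- Here it is the fourth-order terms that cancel, so the coefficient involves derivatives of order
at most three. -/
theorem prolongation_of_totalDerivs_eq₃ (hU : IsOpen U) (hQ : ContDiffOn ℝ ∞ Q U) {j : Fin m}
    {κ ν μ : Fin n} {α : Fin n → ℕ} (hα : α = unitIndex μ + unitIndex ν + unitIndex κ)
    (h : ∀ A : Jet n m → ℝ, totalDerivs α A = totalDeriv κ (totalDeriv ν (totalDeriv μ A)))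
    {p : Jet n m} (hp : base p ∈ U) :
    (prolongation Q p).2 j α = prolong₃ Q j κ ν μ p := by
  simp only [prolongation, h]
  rw [(hasTotalDeriv_totalDeriv_totalDeriv_characteristic hU hQ j κ ν μ).totalDeriv_eq hp,
    prolong₃, sub_add, ← Finset.sum_sub_distrib]
  congr 1
  refine Finset.sum_congr rfl fun l _ => ?_
  rw [xiComp, hα, show unitIndex μ + unitIndex ν + unitIndex κ + unitIndex l =
    unitIndex l + unitIndex μ + unitIndex ν + unitIndex κ by abel]
  ring

end

section
variable {n m : ℕ}

/-! ### The left-hand sides in the jet coordinates -/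

theorem hasTotalDeriv_x {U : Set (Base n m)} (μ ν : Fin n) :
    HasTotalDeriv U μ (fun p => p.1 ν) (fun _ => (Pi.single μ 1 : Fin n → ℝ) ν) := by
  intro p _
  have := ((hasDerivAt_id (0 : ℝ)).mul_const ((Pi.single μ 1 : Fin n → ℝ) ν)).const_add (p.1 ν)
  simpa [HasLineDerivAt, totalVec] using this

theorem HasTotalDeriv.const_mul {U : Set (Base n m)} {μ : Fin n} {A B : Jet n m → ℝ} (r : ℝ)
    (h : HasTotalDeriv U μ A B) : HasTotalDeriv U μ (fun p => r * A p) (fun p => r * B p) :=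
  fun p hp => HasDerivAt.const_mul r (h p hp)

theorem hasTotalDeriv_mulVec {U : Set (Base n m)} (F : Matrix (Fin m) (Fin m) ℝ) (i : Fin m)
    (μ : Fin n) (α : Fin n → ℕ) :
    HasTotalDeriv U μ (fun p => (F.mulVec fun j => p.2 j α) i)
      (fun p => (F.mulVec fun j => p.2 j (α + unitIndex μ)) i) :=
  HasTotalDeriv.sum Finset.univ fun j _ => (hasTotalDeriv_coord μ j α).const_mul (F i j)

theorem totalDeriv_coord (μ : Fin n) (j : Fin m) (α : Fin n → ℕ) (p : Jet n m) :
    totalDeriv μ (fun p => p.2 j α) p = p.2 j (α + unitIndex μ) :=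
  (hasTotalDeriv_coord (U := Set.univ) μ j α).totalDeriv_eq trivial

theorem totalDeriv_reducedVorticity (F : Matrix (Fin m) (Fin m) ℝ) (β : ℝ) (i : Fin m)
    (μ : Fin 2) (p : Jet 2 m) :
    totalDeriv μ (reducedVorticity F β i) p =
      p.2 i (![2, 0] + unitIndex μ) + p.2 i (![0, 2] + unitIndex μ) +
        (F.mulVec fun j => p.2 j (0 + unitIndex μ)) i + β * (Pi.single μ 1 : Fin 2 → ℝ) 1 :=
  ((((hasTotalDeriv_coord (U := Set.univ) μ i _).add (hasTotalDeriv_coord μ i _)).add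
    (hasTotalDeriv_mulVec F i μ 0)).add ((hasTotalDeriv_x μ 1).const_mul β)).totalDeriv_eq trivial

theorem totalDeriv_vorticity (F : Matrix (Fin m) (Fin m) ℝ) (β : ℝ) (i : Fin m)
    (μ : Fin 3) (p : Jet 3 m) :
    totalDeriv μ (vorticity F β i) p =
      p.2 i (![0, 2, 0] + unitIndex μ) + p.2 i (![0, 0, 2] + unitIndex μ) +
        (F.mulVec fun j => p.2 j (0 + unitIndex μ)) i + β * (Pi.single μ 1 : Fin 3 → ℝ) 2 :=
  ((((hasTotalDeriv_coord (U := Set.univ) μ i _).add (hasTotalDeriv_coord μ i _)).add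
    (hasTotalDeriv_mulVec F i μ 0)).add ((hasTotalDeriv_x μ 2).const_mul β)).totalDeriv_eq trivial

theorem reducedSystem_apply (F : Matrix (Fin m) (Fin m) ℝ) (β a : ℝ) (c : Fin m → ℝ) (i : Fin m)
    (p : Jet 2 m) :
    reducedSystem F β a c i p =
      p.2 i ![1, 0] * (p.2 i ![2, 1] + p.2 i ![0, 3] + (F.mulVec fun j => p.2 j ![0, 1]) i + β) -
      p.2 i ![0, 1] * (p.2 i ![3, 0] + p.2 i ![1, 2] + (F.mulVec fun j => p.2 j ![1, 0]) i) +
      F.mulVec c i + a * β := by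
  simp only [reducedSystem, poisson, totalDeriv_coord, totalDeriv_reducedVorticity]
  rw [show (![2, 0] + unitIndex 0 : Fin 2 → ℕ) = ![3, 0] by decide,
    show (![2, 0] + unitIndex 1 : Fin 2 → ℕ) = ![2, 1] by decide,
    show (![0, 2] + unitIndex 0 : Fin 2 → ℕ) = ![1, 2] by decide,
    show (![0, 2] + unitIndex 1 : Fin 2 → ℕ) = ![0, 3] by decide,
    show (0 + unitIndex 0 : Fin 2 → ℕ) = ![1, 0] by decide,
    show (0 + unitIndex 1 : Fin 2 → ℕ) = ![0, 1] by decide]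
  simp

theorem model_apply (F : Matrix (Fin m) (Fin m) ℝ) (β : ℝ) (i : Fin m) (p : Jet 3 m) :
    model F β i p =
      p.2 i ![1, 2, 0] + p.2 i ![1, 0, 2] + (F.mulVec fun j => p.2 j ![1, 0, 0]) i +
      (p.2 i ![0, 1, 0] *
        (p.2 i ![0, 2, 1] + p.2 i ![0, 0, 3] + (F.mulVec fun j => p.2 j ![0, 0, 1]) i + β) -
      p.2 i ![0, 0, 1] *
        (p.2 i ![0, 3, 0] + p.2 i ![0, 1, 2] + (F.mulVec fun j => p.2 j ![0, 1, 0]) i)) := by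
  simp only [model, poisson, totalDeriv_coord, totalDeriv_vorticity]
  rw [show (![0, 2, 0] + unitIndex 0 : Fin 3 → ℕ) = ![1, 2, 0] by decide,
    show (![0, 2, 0] + unitIndex 1 : Fin 3 → ℕ) = ![0, 3, 0] by decide,
    show (![0, 2, 0] + unitIndex 2 : Fin 3 → ℕ) = ![0, 2, 1] by decide,
    show (![0, 0, 2] + unitIndex 0 : Fin 3 → ℕ) = ![1, 0, 2] by decide,
    show (![0, 0, 2] + unitIndex 1 : Fin 3 → ℕ) = ![0, 1, 2] by decide,
    show (![0, 0, 2] + unitIndex 2 : Fin 3 → ℕ) = ![0, 0, 3] by decide,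
    show (0 + unitIndex 0 : Fin 3 → ℕ) = ![1, 0, 0] by decide,
    show (0 + unitIndex 1 : Fin 3 → ℕ) = ![0, 1, 0] by decide,
    show (0 + unitIndex 2 : Fin 3 → ℕ) = ![0, 0, 1] by decide]
  simp

/-- The derivative of the reduced system along a tangent vector of the jet space. -/
theorem lineDeriv_reducedSystem (F : Matrix (Fin m) (Fin m) ℝ) (β a : ℝ) (c : Fin m → ℝ)
    (i : Fin m) (p V : Jet 2 m) :
    lineDeriv ℝ (reducedSystem F β a c i) p V =
      V.2 i ![1, 0] * (p.2 i ![2, 1] + p.2 i ![0, 3] + (F.mulVec fun j => p.2 j ![0, 1]) i + β) +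
      p.2 i ![1, 0] * (V.2 i ![2, 1] + V.2 i ![0, 3] + (F.mulVec fun j => V.2 j ![0, 1]) i) -
      (V.2 i ![0, 1] * (p.2 i ![3, 0] + p.2 i ![1, 2] + (F.mulVec fun j => p.2 j ![1, 0]) i) +
      p.2 i ![0, 1] * (V.2 i ![3, 0] + V.2 i ![1, 2] + (F.mulVec fun j => V.2 j ![1, 0]) i)) := by
  have hco : ∀ (j : Fin m) (α : Fin 2 → ℕ),
      HasDerivAt (fun t : ℝ => (p + t • V).2 j α) (V.2 j α) 0 := by
    intro j α
    have := ((hasDerivAt_id (0 : ℝ)).mul_const (V.2 j α)).const_add (p.2 j α)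
    simpa using this
  have hF : ∀ (α : Fin 2 → ℕ),
      HasDerivAt (fun t : ℝ => (F.mulVec fun j => (p + t • V).2 j α) i)
        ((F.mulVec fun j => V.2 j α) i) 0 := fun α =>
    HasDerivAt.fun_sum (u := Finset.univ) fun j _ => (hco j α).const_mul (F i j)
  have := ((((hco i ![1, 0]).mul ((((hco i ![2, 1]).add (hco i ![0, 3])).add (hF ![0, 1])).add_const
    β)).sub ((hco i ![0, 1]).mul (((hco i ![3, 0]).add (hco i ![1, 2])).add (hF ![1, 0])))).add_const
    (F.mulVec c i)).add_const (a * β)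
  have h2 : HasLineDerivAt ℝ (reducedSystem F β a c i) _ p V :=
    HasDerivAt.congr_of_eventuallyEq this
      (Filter.Eventually.of_forall fun t => reducedSystem_apply F β a c i _)
  rw [h2.lineDeriv]
  simp

/-- The derivative of the model along a tangent vector depends on finitely many coordinates. -/
theorem lineDeriv_model_congr (F : Matrix (Fin m) (Fin m) ℝ) (β : ℝ) (i : Fin m)
    (p V V' : Jet 3 m)
    (h : ∀ j, ∀ α ∈ ({![1, 0, 0], ![0, 1, 0], ![0, 0, 1], ![1, 2, 0], ![1, 0, 2], ![0, 3, 0],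
      ![0, 2, 1], ![0, 1, 2], ![0, 0, 3]} : Set (Fin 3 → ℕ)), V.2 j α = V'.2 j α) :
    lineDeriv ℝ (model F β i) p V = lineDeriv ℝ (model F β i) p V' := by
  unfold lineDeriv
  congr 1
  ext t
  have h' : ∀ j, ∀ α ∈ ({![1, 0, 0], ![0, 1, 0], ![0, 0, 1], ![1, 2, 0], ![1, 0, 2], ![0, 3, 0],
      ![0, 2, 1], ![0, 1, 2], ![0, 0, 3]} : Set (Fin 3 → ℕ)),
      (p + t • V).2 j α = (p + t • V').2 j α := fun j α hα => by
    simp [h j α hα]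
  simp only [model_apply]
  rw [h' i ![1, 2, 0] (by simp), h' i ![1, 0, 2] (by simp), h' i ![0, 1, 0] (by simp),
    h' i ![0, 0, 1] (by simp), h' i ![0, 2, 1] (by simp), h' i ![0, 0, 3] (by simp),
    h' i ![0, 3, 0] (by simp), h' i ![0, 1, 2] (by simp),
    funext fun j => h' j ![1, 0, 0] (by simp), funext fun j => h' j ![0, 1, 0] (by simp),
    funext fun j => h' j ![0, 0, 1] (by simp)]

/-! ### Prolongation coefficients entering the reduced system. -/

variable {U : Set (Base 2 m)} {Q : VectorFieldOn 2 m} {p : Jet 2 m}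

theorem prolongation_10 (hU : IsOpen U) (hQ : ContDiffOn ℝ ∞ Q U) (j : Fin m)
    (hp : base p ∈ U) : (prolongation Q p).2 j ![1, 0] = prolong₁ Q j 0 p :=
  prolongation_of_totalDerivs_eq₁ hU hQ (by decide) (fun _ => rfl) hp

theorem prolongation_01 (hU : IsOpen U) (hQ : ContDiffOn ℝ ∞ Q U) (j : Fin m)
    (hp : base p ∈ U) : (prolongation Q p).2 j ![0, 1] = prolong₁ Q j 1 p :=
  prolongation_of_totalDerivs_eq₁ hU hQ (by decide) (fun _ => rfl) hp

theorem prolongation_30 (hU : IsOpen U) (hQ : ContDiffOn ℝ ∞ Q U) (j : Fin m)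
    (hp : base p ∈ U) : (prolongation Q p).2 j ![3, 0] = prolong₃ Q j 0 0 0 p :=
  prolongation_of_totalDerivs_eq₃ hU hQ (by decide) (fun _ => rfl) hp

theorem prolongation_21 (hU : IsOpen U) (hQ : ContDiffOn ℝ ∞ Q U) (j : Fin m)
    (hp : base p ∈ U) : (prolongation Q p).2 j ![2, 1] = prolong₃ Q j 0 0 1 p :=
  prolongation_of_totalDerivs_eq₃ hU hQ (by decide) (fun _ => rfl) hp

theorem prolongation_12 (hU : IsOpen U) (hQ : ContDiffOn ℝ ∞ Q U) (j : Fin m)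
    (hp : base p ∈ U) : (prolongation Q p).2 j ![1, 2] = prolong₃ Q j 0 1 1 p :=
  prolongation_of_totalDerivs_eq₃ hU hQ (by decide) (fun _ => rfl) hp

theorem prolongation_03 (hU : IsOpen U) (hQ : ContDiffOn ℝ ∞ Q U) (j : Fin m)
    (hp : base p ∈ U) : (prolongation Q p).2 j ![0, 3] = prolong₃ Q j 1 1 1 p :=
  prolongation_of_totalDerivs_eq₃ hU hQ (by decide) (fun _ => rfl) hp

end

section
variable {m : ℕ}

/-! ### The invariance criterion at jets without second order derivatives -/

/-- The jet over `b` with the gradients `(g₁, g₂)`, the third order derivatives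
`t₃₀, t₂₁, t₁₂, t₀₃` and all other derivatives zero. -/
def thirdJet (b : Base 2 m) (g₁ g₂ t₃₀ t₂₁ t₁₂ t₀₃ : Fin m → ℝ) : Jet 2 m :=
  (b.1, fun j α => match α 0, α 1 with
    | 0, 0 => b.2 j
    | 1, 0 => g₁ j
    | 0, 1 => g₂ j
    | 3, 0 => t₃₀ j
    | 2, 1 => t₂₁ j
    | 1, 2 => t₁₂ j
    | 0, 3 => t₀₃ j
    | _, _ => 0)

variable (b : Base 2 m) (g₁ g₂ t₃₀ t₂₁ t₁₂ t₀₃ : Fin m → ℝ) (Q : VectorFieldOn 2 m)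

theorem base_thirdJet : base (thirdJet b g₁ g₂ t₃₀ t₂₁ t₁₂ t₀₃) = b := rfl

/-- The horizontal vector `e_μ` with the vertical part `g`. -/
def slope (μ : Fin 2) (g : Fin m → ℝ) : Base 2 m := (Pi.single μ 1, g)

/-- The first order prolongation coefficient of `Q` in the direction `x`. -/
def coeff₁ (j : Fin m) (x : Base 2 m) : ℝ :=
  fderiv ℝ (etaComp Q j) b x -
    (fderiv ℝ (xiComp Q 0) b x * g₁ j + fderiv ℝ (xiComp Q 1) b x * g₂ j)

/-- The part of the third order prolongation coefficients with third derivatives of `Q`. -/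
def coeff₃ (j : Fin m) (x y z : Base 2 m) : ℝ :=
  fderiv ℝ (fderiv ℝ (fderiv ℝ (etaComp Q j))) b x y z -
    (fderiv ℝ (fderiv ℝ (fderiv ℝ (xiComp Q 0))) b x y z * g₁ j +
      fderiv ℝ (fderiv ℝ (fderiv ℝ (xiComp Q 1))) b x y z * g₂ j)

theorem prolong₁_thirdJet_zero (j : Fin m) :
    prolong₁ Q j 0 (thirdJet b g₁ g₂ t₃₀ t₂₁ t₁₂ t₀₃) = coeff₁ b g₁ g₂ Q j (slope 0 g₁) := by
  simp only [prolong₁, Fin.sum_univ_two]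
  rfl

theorem prolong₁_thirdJet_one (j : Fin m) :
    prolong₁ Q j 1 (thirdJet b g₁ g₂ t₃₀ t₂₁ t₁₂ t₀₃) = coeff₁ b g₁ g₂ Q j (slope 1 g₂) := by
  simp only [prolong₁, Fin.sum_univ_two]
  rfl

theorem vertical_thirdJet_eq_zero (μ ν : Fin 2) :
    vertical (unitIndex μ + unitIndex ν) (thirdJet b g₁ g₂ t₃₀ t₂₁ t₁₂ t₀₃) = 0 := by
  fin_cases μ <;> fin_cases ν <;> rfl

theorem thirdJet_second_eq_zero (j : Fin m) (μ ν : Fin 2) :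
    (thirdJet b g₁ g₂ t₃₀ t₂₁ t₁₂ t₀₃).2 j (unitIndex μ + unitIndex ν) = 0 := by
  fin_cases μ <;> fin_cases ν <;> rfl

/-- With second-order derivatives zero, only two kinds of terms survive: third derivatives of the
components of `Q`, and first derivatives times third-order jet coordinates. The vectors `x`, `y`,
`z` are parameters so that each use can name the slopes and discharge the hypotheses by `rfl`. -/
theorem prolong₃_thirdJet (j : Fin m) (κ ν μ : Fin 2) {t : Fin m → ℝ} {x y z : Base 2 m}
    (hx : tangent κ (thirdJet b g₁ g₂ t₃₀ t₂₁ t₁₂ t₀₃) = x)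
    (hy : tangent ν (thirdJet b g₁ g₂ t₃₀ t₂₁ t₁₂ t₀₃) = y)
    (hz : tangent μ (thirdJet b g₁ g₂ t₃₀ t₂₁ t₁₂ t₀₃) = z)
    (ht : vertical (unitIndex μ + unitIndex ν + unitIndex κ)
      (thirdJet b g₁ g₂ t₃₀ t₂₁ t₁₂ t₀₃) = (0, t)) :
    prolong₃ Q j κ ν μ (thirdJet b g₁ g₂ t₃₀ t₂₁ t₁₂ t₀₃) =
      coeff₃ b g₁ g₂ Q j x y z + coeff₁ b g₁ g₂ Q j (0, t) -
      ∑ l, (fderiv ℝ (xiComp Q l) b z * (thirdJet b g₁ g₂ t₃₀ t₂₁ t₁₂ t₀₃).2 j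
          (unitIndex l + unitIndex ν + unitIndex κ) +
        fderiv ℝ (xiComp Q l) b y * (thirdJet b g₁ g₂ t₃₀ t₂₁ t₁₂ t₀₃).2 j
          (unitIndex l + unitIndex μ + unitIndex κ) +
        fderiv ℝ (xiComp Q l) b x * (thirdJet b g₁ g₂ t₃₀ t₂₁ t₁₂ t₀₃).2 j
          (unitIndex l + unitIndex μ + unitIndex ν)) := by
  simp only [prolong₃, total₃, total₁, vertical_thirdJet_eq_zero, thirdJet_second_eq_zero,
    base_thirdJet, hx, hy, hz, ht, map_zero, zero_apply, mul_zero, add_zero,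
    zero_add, Fin.sum_univ_two, coeff₃, coeff₁]
  rw [show (thirdJet b g₁ g₂ t₃₀ t₂₁ t₁₂ t₀₃).2 j (unitIndex 0) = g₁ j from rfl,
    show (thirdJet b g₁ g₂ t₃₀ t₂₁ t₁₂ t₀₃).2 j (unitIndex 1) = g₂ j from rfl]
  ring

variable {b Q} {U : Set (Base 2 m)} {F : Matrix (Fin m) (Fin m) ℝ} {β a : ℝ} {c : Fin m → ℝ}

/-- The invariance criterion at the jets without second order derivatives. -/
theorem criterion_thirdJet (hU : IsOpen U)
    (hQ : Q ∈ maxLieInvarianceAlgebra (reducedSystem F β a c) U) (hb : b ∈ U)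
    (hE : ∀ k, g₁ k * (t₂₁ k + t₀₃ k + F.mulVec g₂ k + β) -
      g₂ k * (t₃₀ k + t₁₂ k + F.mulVec g₁ k) + F.mulVec c k + a * β = 0) (i : Fin m) :
    coeff₁ b g₁ g₂ Q i (slope 0 g₁) * (t₂₁ i + t₀₃ i + F.mulVec g₂ i + β) +
    g₁ i * ((coeff₃ b g₁ g₂ Q i (slope 0 g₁) (slope 0 g₁) (slope 1 g₂) +
          coeff₁ b g₁ g₂ Q i (0, t₂₁) -
          (fderiv ℝ (xiComp Q 0) b (slope 1 g₂) * t₃₀ i +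
            fderiv ℝ (xiComp Q 1) b (slope 1 g₂) * t₂₁ i +
            2 * (fderiv ℝ (xiComp Q 0) b (slope 0 g₁) * t₂₁ i +
              fderiv ℝ (xiComp Q 1) b (slope 0 g₁) * t₁₂ i))) +
        (coeff₃ b g₁ g₂ Q i (slope 1 g₂) (slope 1 g₂) (slope 1 g₂) +
          coeff₁ b g₁ g₂ Q i (0, t₀₃) -
          3 * (fderiv ℝ (xiComp Q 0) b (slope 1 g₂) * t₁₂ i +
            fderiv ℝ (xiComp Q 1) b (slope 1 g₂) * t₀₃ i)) +
        F.mulVec (fun j => coeff₁ b g₁ g₂ Q j (slope 1 g₂)) i) -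
    (coeff₁ b g₁ g₂ Q i (slope 1 g₂) * (t₃₀ i + t₁₂ i + F.mulVec g₁ i) +
      g₂ i * ((coeff₃ b g₁ g₂ Q i (slope 0 g₁) (slope 0 g₁) (slope 0 g₁) +
          coeff₁ b g₁ g₂ Q i (0, t₃₀) -
          3 * (fderiv ℝ (xiComp Q 0) b (slope 0 g₁) * t₃₀ i +
            fderiv ℝ (xiComp Q 1) b (slope 0 g₁) * t₂₁ i)) +
        (coeff₃ b g₁ g₂ Q i (slope 0 g₁) (slope 1 g₂) (slope 1 g₂) +
          coeff₁ b g₁ g₂ Q i (0, t₁₂) -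
          (2 * (fderiv ℝ (xiComp Q 0) b (slope 1 g₂) * t₂₁ i +
            fderiv ℝ (xiComp Q 1) b (slope 1 g₂) * t₁₂ i) +
            fderiv ℝ (xiComp Q 0) b (slope 0 g₁) * t₁₂ i +
            fderiv ℝ (xiComp Q 1) b (slope 0 g₁) * t₀₃ i)) +
        F.mulVec (fun j => coeff₁ b g₁ g₂ Q j (slope 0 g₁)) i)) = 0 := by
  have hp : base (thirdJet b g₁ g₂ t₃₀ t₂₁ t₁₂ t₀₃) ∈ U := hb
  have h := hQ.2 _ hp (fun k => (reducedSystem_apply F β a c k _).trans (hE k)) i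
  rw [lineDeriv_reducedSystem, prolongation_10 hU hQ.1 i hp, prolongation_01 hU hQ.1 i hp,
    prolongation_21 hU hQ.1 i hp, prolongation_12 hU hQ.1 i hp, prolongation_30 hU hQ.1 i hp,
    prolongation_03 hU hQ.1 i hp, funext fun j => prolongation_10 hU hQ.1 j hp,
    funext fun j => prolongation_01 hU hQ.1 j hp,
    prolong₃_thirdJet b g₁ g₂ t₃₀ t₂₁ t₁₂ t₀₃ Q i 0 0 0 (t := t₃₀) rfl rfl rfl rfl,
    prolong₃_thirdJet b g₁ g₂ t₃₀ t₂₁ t₁₂ t₀₃ Q i 0 0 1 (t := t₂₁) rfl rfl rfl rfl,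
    prolong₃_thirdJet b g₁ g₂ t₃₀ t₂₁ t₁₂ t₀₃ Q i 0 1 1 (t := t₁₂) rfl rfl rfl rfl,
    prolong₃_thirdJet b g₁ g₂ t₃₀ t₂₁ t₁₂ t₀₃ Q i 1 1 1 (t := t₀₃) rfl rfl rfl rfl] at h
  simp only [prolong₁_thirdJet_zero, prolong₁_thirdJet_one, Fin.sum_univ_two] at h
  -- The coordinates of `thirdJet` at concrete multi-indices reduce by computation.
  change coeff₁ b g₁ g₂ Q i (slope 0 g₁) * (t₂₁ i + t₀₃ i + F.mulVec g₂ i + β) +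
    g₁ i * ((coeff₃ b g₁ g₂ Q i (slope 0 g₁) (slope 0 g₁) (slope 1 g₂) +
          coeff₁ b g₁ g₂ Q i (0, t₂₁) -
          (fderiv ℝ (xiComp Q 0) b (slope 1 g₂) * t₃₀ i +
            fderiv ℝ (xiComp Q 0) b (slope 0 g₁) * t₂₁ i +
            fderiv ℝ (xiComp Q 0) b (slope 0 g₁) * t₂₁ i +
            (fderiv ℝ (xiComp Q 1) b (slope 1 g₂) * t₂₁ i +
            fderiv ℝ (xiComp Q 1) b (slope 0 g₁) * t₁₂ i +
            fderiv ℝ (xiComp Q 1) b (slope 0 g₁) * t₁₂ i))) +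
        (coeff₃ b g₁ g₂ Q i (slope 1 g₂) (slope 1 g₂) (slope 1 g₂) +
          coeff₁ b g₁ g₂ Q i (0, t₀₃) -
          (fderiv ℝ (xiComp Q 0) b (slope 1 g₂) * t₁₂ i +
            fderiv ℝ (xiComp Q 0) b (slope 1 g₂) * t₁₂ i +
            fderiv ℝ (xiComp Q 0) b (slope 1 g₂) * t₁₂ i +
            (fderiv ℝ (xiComp Q 1) b (slope 1 g₂) * t₀₃ i +
            fderiv ℝ (xiComp Q 1) b (slope 1 g₂) * t₀₃ i +
            fderiv ℝ (xiComp Q 1) b (slope 1 g₂) * t₀₃ i))) +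
        F.mulVec (fun j => coeff₁ b g₁ g₂ Q j (slope 1 g₂)) i) -
    (coeff₁ b g₁ g₂ Q i (slope 1 g₂) * (t₃₀ i + t₁₂ i + F.mulVec g₁ i) +
      g₂ i * ((coeff₃ b g₁ g₂ Q i (slope 0 g₁) (slope 0 g₁) (slope 0 g₁) +
          coeff₁ b g₁ g₂ Q i (0, t₃₀) -
          (fderiv ℝ (xiComp Q 0) b (slope 0 g₁) * t₃₀ i +
            fderiv ℝ (xiComp Q 0) b (slope 0 g₁) * t₃₀ i +
            fderiv ℝ (xiComp Q 0) b (slope 0 g₁) * t₃₀ i +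
            (fderiv ℝ (xiComp Q 1) b (slope 0 g₁) * t₂₁ i +
            fderiv ℝ (xiComp Q 1) b (slope 0 g₁) * t₂₁ i +
            fderiv ℝ (xiComp Q 1) b (slope 0 g₁) * t₂₁ i))) +
        (coeff₃ b g₁ g₂ Q i (slope 0 g₁) (slope 1 g₂) (slope 1 g₂) +
          coeff₁ b g₁ g₂ Q i (0, t₁₂) -
          (fderiv ℝ (xiComp Q 0) b (slope 1 g₂) * t₂₁ i +
            fderiv ℝ (xiComp Q 0) b (slope 1 g₂) * t₂₁ i +
            fderiv ℝ (xiComp Q 0) b (slope 0 g₁) * t₁₂ i +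
            (fderiv ℝ (xiComp Q 1) b (slope 1 g₂) * t₁₂ i +
            fderiv ℝ (xiComp Q 1) b (slope 1 g₂) * t₁₂ i +
            fderiv ℝ (xiComp Q 1) b (slope 0 g₁) * t₀₃ i))) +
        F.mulVec (fun j => coeff₁ b g₁ g₂ Q j (slope 0 g₁)) i)) = 0 at h
  linear_combination h

/-- Third order derivatives with which a jet satisfies the reduced system. -/
theorem exists_third_order (hg : ∀ k, g₁ k ^ 2 + g₂ k ^ 2 ≠ 0) :
    ∃ s r : Fin m → ℝ, ∀ k, g₁ k * (r k + F.mulVec g₂ k + β) -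
      g₂ k * (s k + F.mulVec g₁ k) + F.mulVec c k + a * β = 0 := by
  -- With residue `E`, one needs `g₁ r - g₂ s = -E`; the solution of least norm is `(s, r) = E (g₂,
  -- -g₁) / |g|²`.
  refine ⟨fun k => (g₁ k * (F.mulVec g₂ k + β) - g₂ k * F.mulVec g₁ k + F.mulVec c k + a * β) *
      g₂ k / (g₁ k ^ 2 + g₂ k ^ 2), fun k => -(g₁ k * (F.mulVec g₂ k + β) - g₂ k * F.mulVec g₁ k +
      F.mulVec c k + a * β) * g₁ k / (g₁ k ^ 2 + g₂ k ^ 2), fun k => ?_⟩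
  have := hg k
  field_simp
  ring

theorem coeff₁_add (j : Fin m) (x y : Base 2 m) :
    coeff₁ b g₁ g₂ Q j (x + y) = coeff₁ b g₁ g₂ Q j x + coeff₁ b g₁ g₂ Q j y := by
  simp only [coeff₁, map_add]
  ring

/-- The dependence of the invariance criterion on the third order derivatives. -/
theorem criterion_third_order (hU : IsOpen U)
    (hQ : Q ∈ maxLieInvarianceAlgebra (reducedSystem F β a c) U) (hb : b ∈ U)
    (hg : ∀ k, g₁ k ^ 2 + g₂ k ^ 2 ≠ 0)
    (ht : ∀ k, g₁ k * (t₂₁ k + t₀₃ k) = g₂ k * (t₃₀ k + t₁₂ k)) (i : Fin m) :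
    coeff₁ b g₁ g₂ Q i (slope 0 g₁) * (t₂₁ i + t₀₃ i) +
    g₁ i * ((coeff₁ b g₁ g₂ Q i (0, t₂₁) -
          (fderiv ℝ (xiComp Q 0) b (slope 1 g₂) * t₃₀ i +
            fderiv ℝ (xiComp Q 1) b (slope 1 g₂) * t₂₁ i +
            2 * (fderiv ℝ (xiComp Q 0) b (slope 0 g₁) * t₂₁ i +
              fderiv ℝ (xiComp Q 1) b (slope 0 g₁) * t₁₂ i))) +
        (coeff₁ b g₁ g₂ Q i (0, t₀₃) -
          3 * (fderiv ℝ (xiComp Q 0) b (slope 1 g₂) * t₁₂ i +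
            fderiv ℝ (xiComp Q 1) b (slope 1 g₂) * t₀₃ i))) -
    (coeff₁ b g₁ g₂ Q i (slope 1 g₂) * (t₃₀ i + t₁₂ i) +
      g₂ i * ((coeff₁ b g₁ g₂ Q i (0, t₃₀) -
          3 * (fderiv ℝ (xiComp Q 0) b (slope 0 g₁) * t₃₀ i +
            fderiv ℝ (xiComp Q 1) b (slope 0 g₁) * t₂₁ i)) +
        (coeff₁ b g₁ g₂ Q i (0, t₁₂) -
          (2 * (fderiv ℝ (xiComp Q 0) b (slope 1 g₂) * t₂₁ i +
            fderiv ℝ (xiComp Q 1) b (slope 1 g₂) * t₁₂ i) +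
            fderiv ℝ (xiComp Q 0) b (slope 0 g₁) * t₁₂ i +
            fderiv ℝ (xiComp Q 1) b (slope 0 g₁) * t₀₃ i)))) = 0 := by
  obtain ⟨s, r, hsr⟩ := exists_third_order (F := F) (β := β) (a := a) (c := c) g₁ g₂ hg
  -- Both jets have the same first-order part, and by `ht` the perturbed one still solves the
  -- system; in the difference every term free of `t` cancels.
  have h₀ := criterion_thirdJet g₁ g₂ s 0 0 r hU hQ hb
    (fun k => by simpa using hsr k) i
  have h₁ := criterion_thirdJet g₁ g₂ (s + t₃₀) t₂₁ t₁₂ (r + t₀₃) hU hQ hb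
    (fun k => by simp only [Pi.add_apply]; linear_combination hsr k + ht k) i
  have e (u v : Fin m → ℝ) : ((0, u + v) : Base 2 m) = (0, u) + (0, v) := by simp
  have e₀ : coeff₁ b g₁ g₂ Q i (0, 0) = 0 := by
    simp only [coeff₁, Prod.mk_zero_zero, map_zero]; ring
  simp only [e, coeff₁_add, Pi.add_apply] at h₁
  simp only [e₀, Pi.zero_apply] at h₀
  linear_combination h₁ - h₀

end

section
variable {n m : ℕ}

/-! ### Solution of the determining equations -/

theorem map_vertical (L : Base n m →L[ℝ] ℝ) (g : Fin m → ℝ) :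
    L (0, g) = ∑ j, g j * L (0, Pi.single j 1) := by
  have := LinearMap.pi_apply_eq_sum_univ (L.toLinearMap ∘ₗ LinearMap.inr ℝ (Fin n → ℝ) (Fin m → ℝ)) g
  simp only [LinearMap.comp_apply, LinearMap.inr_apply, ContinuousLinearMap.coe_coe,
    smul_eq_mul] at this
  rw [this]
  refine Finset.sum_congr rfl fun j _ => ?_
  congr 3
  ext k
  simp [Pi.single_apply, eq_comm]

/-- A direction in which a function is constant annihilates its third derivative. -/
theorem fderiv_third_eq_zero {U : Set (Base n m)} (hU : IsOpen U) {g : Base n m → ℝ}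
    (hg : ContDiffOn ℝ ∞ g U) {z : Base n m} (hz : ∀ b ∈ U, fderiv ℝ g b z = 0) {b : Base n m}
    (hb : b ∈ U) (x y : Base n m) :
    fderiv ℝ (fderiv ℝ (fderiv ℝ g)) b x y z = 0 ∧ fderiv ℝ (fderiv ℝ (fderiv ℝ g)) b x z y = 0 ∧
      fderiv ℝ (fderiv ℝ (fderiv ℝ g)) b z x y = 0 := by
  have hg1 := contDiffOn_fderiv hU hg
  have hg2 := contDiffOn_fderiv hU hg1
  have h2 (x : Base n m) : ∀ b ∈ U, fderiv ℝ (fderiv ℝ g) b x z = 0 := by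
    intro b hb
    have e1 : fderiv ℝ (fun b => fderiv ℝ g b z) b = 0 := by
      have : (fun b => fderiv ℝ g b z) =ᶠ[nhds b] fun _ => 0 :=
        Filter.eventually_of_mem (hU.mem_nhds hb) hz
      rw [this.fderiv_eq]; simp
    rw [fderiv_clm_apply (differentiableAt_of_contDiffOn hU hg1 b hb)
      (differentiableAt_const z)] at e1
    simpa using congrArg (fun L => L x) e1
  have h3 (x y w : Base n m) (hyw : ∀ b ∈ U, fderiv ℝ (fderiv ℝ g) b y w = 0) :
      fderiv ℝ (fderiv ℝ (fderiv ℝ g)) b x y w = 0 := by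
    have e1 : fderiv ℝ (fun b => fderiv ℝ (fderiv ℝ g) b y w) b = 0 := by
      have : (fun b => fderiv ℝ (fderiv ℝ g) b y w) =ᶠ[nhds b] fun _ => 0 :=
        Filter.eventually_of_mem (hU.mem_nhds hb) hyw
      rw [this.fderiv_eq]; simp
    have hd := differentiableAt_of_contDiffOn hU hg2 b hb
    rw [fderiv_clm_apply (hd.clm_apply (differentiableAt_const y)) (differentiableAt_const w),
      fderiv_clm_apply hd (differentiableAt_const y)] at e1
    simpa using congrArg (fun L => L x) e1
  have h4 := h3 x z y fun b hb => by rw [fderiv_fderiv_symm hU hg hb, h2 y b hb]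
  refine ⟨h3 x y z (h2 y), h4, ?_⟩
  rw [fderiv_fderiv_symm hU hg1 hb, h4]

/-! ### Determining equations from the terms with third-order derivatives. -/

variable {Q : VectorFieldOn 2 m} {b : Base 2 m} {U : Set (Base 2 m)}
  {F : Matrix (Fin m) (Fin m) ℝ} {β a : ℝ} {c : Fin m → ℝ}

theorem coeff₁_single (g₁ g₂ : Fin m → ℝ) (i j : Fin m) (r : ℝ) :
    coeff₁ b g₁ g₂ Q i (0, Pi.single j r) = r * (fderiv ℝ (etaComp Q i) b (0, Pi.single j 1) -
      (fderiv ℝ (xiComp Q 0) b (0, Pi.single j 1) * g₁ i +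
        fderiv ℝ (xiComp Q 1) b (0, Pi.single j 1) * g₂ i)) := by
  have : ((0, Pi.single j r) : Base 2 m) = r • (0, Pi.single j 1) := by
    simp [← Pi.single_smul]
  simp only [coeff₁, this, map_smul, smul_eq_mul]
  ring

theorem fderiv_other_layer (hU : IsOpen U)
    (hQ : Q ∈ maxLieInvarianceAlgebra (reducedSystem F β a c) U) (hb : b ∈ U) {i j : Fin m}
    (hij : i ≠ j) :
    fderiv ℝ (etaComp Q i) b (0, Pi.single j 1) = 0 ∧
      fderiv ℝ (xiComp Q 0) b (0, Pi.single j 1) = 0 ∧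
      fderiv ℝ (xiComp Q 1) b (0, Pi.single j 1) = 0 := by
  have key (x y : ℝ) (hxy : x ^ 2 + y ^ 2 ≠ 0) :
      fderiv ℝ (etaComp Q i) b (0, Pi.single j 1) -
        (fderiv ℝ (xiComp Q 0) b (0, Pi.single j 1) * x +
          fderiv ℝ (xiComp Q 1) b (0, Pi.single j 1) * y) = 0 := by
    -- The gradient is `(x, y)` in layer `i` and the orthogonal `(-y, x)` in layer `j`. The
    -- perturbation lives in layer `j` only and is proportional to `(-y, x)`, so it is admissible
    -- there, while in equation `i` it enters with the factor `x² + y²`. The gradient `(1, 0)`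
    -- elsewhere only keeps it nonzero.
    have h := criterion_third_order (fun k => if k = i then x else if k = j then -y else 1)
      (fun k => if k = i then y else if k = j then x else 0)
      (Pi.single j (-y)) 0 0 (Pi.single j x) hU hQ hb
      (fun k => by
        rcases eq_or_ne k i with rfl | hi
        · simpa using hxy
        · rcases eq_or_ne k j with rfl | hj
          · simpa [hi, add_comm] using hxy
          · simp [hi, hj])
      (fun k => by
        rcases eq_or_ne k j with rfl | hj
        · simp [hij.symm, mul_comm]
        · simp [hj]) i
    have e₀ (g₁ g₂ : Fin m → ℝ) : coeff₁ b g₁ g₂ Q i (0, 0) = 0 := by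
      simp only [coeff₁, Prod.mk_zero_zero, map_zero]; ring
    simp only [coeff₁_single, e₀, Pi.single_eq_of_ne hij, Pi.zero_apply, if_true] at h
    exact (mul_eq_zero.1 (show (x ^ 2 + y ^ 2) * _ = 0 by linear_combination h)).resolve_left hxy
  have h1 := key 1 0 (by norm_num)
  have h2 := key (-1) 0 (by norm_num)
  have h3 := key 0 1 (by norm_num)
  refine ⟨?_, ?_, ?_⟩ <;> linarith

/-- The existence of a second layer is essential: independence of `v^j` is read from the equation of
another layer. -/
theorem fderiv_xiComp_vertical (hm : 2 ≤ m) (hU : IsOpen U)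
    (hQ : Q ∈ maxLieInvarianceAlgebra (reducedSystem F β a c) U) (hb : b ∈ U) (μ : Fin 2)
    (g : Fin m → ℝ) : fderiv ℝ (xiComp Q μ) b (0, g) = 0 := by
  rw [map_vertical]
  refine Finset.sum_eq_zero fun j _ => ?_
  have : Nontrivial (Fin m) := Fin.nontrivial_iff_two_le.2 hm
  obtain ⟨i, hi⟩ := exists_ne j
  have h := fderiv_other_layer hU hQ hb hi
  fin_cases μ
  · simp [h.2.1]
  · simp [h.2.2]

theorem fderiv_etaComp_vertical (hU : IsOpen U)
    (hQ : Q ∈ maxLieInvarianceAlgebra (reducedSystem F β a c) U) (hb : b ∈ U) (i : Fin m)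
    (g : Fin m → ℝ) :
    fderiv ℝ (etaComp Q i) b (0, g) = fderiv ℝ (etaComp Q i) b (0, Pi.single i 1) * g i := by
  rw [map_vertical, Finset.sum_eq_single i, mul_comm]
  · exact fun j _ hj => by rw [(fderiv_other_layer hU hQ hb hj.symm).1, mul_zero]
  · simp

theorem slope_eq (μ : Fin 2) (g : Fin m → ℝ) : slope μ g = slope μ 0 + (0, g) := by
  simp [slope]

theorem fderiv_xiComp_slope (hm : 2 ≤ m) (hU : IsOpen U)
    (hQ : Q ∈ maxLieInvarianceAlgebra (reducedSystem F β a c) U) (hb : b ∈ U) (l μ : Fin 2)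
    (g : Fin m → ℝ) : fderiv ℝ (xiComp Q l) b (slope μ g) = fderiv ℝ (xiComp Q l) b (slope μ 0) := by
  rw [slope_eq, map_add, fderiv_xiComp_vertical hm hU hQ hb, add_zero]

theorem fderiv_third_xiComp_slope (hm : 2 ≤ m) (hU : IsOpen U)
    (hQ : Q ∈ maxLieInvarianceAlgebra (reducedSystem F β a c) U) (hb : b ∈ U) (l κ ν μ : Fin 2)
    (g g' g'' : Fin m → ℝ) :
    fderiv ℝ (fderiv ℝ (fderiv ℝ (xiComp Q l))) b (slope κ g) (slope ν g') (slope μ g'') =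
      fderiv ℝ (fderiv ℝ (fderiv ℝ (xiComp Q l))) b (slope κ 0) (slope ν 0) (slope μ 0) := by
  have h (f : Fin m → ℝ) (x y : Base 2 m) :=
    fderiv_third_eq_zero hU (contDiffOn_xiComp hQ.1 l) (z := (0, f))
      (fun b hb => fderiv_xiComp_vertical hm hU hQ hb l f) hb x y
  rw [slope_eq κ g, slope_eq ν g', slope_eq μ g'']
  simp only [map_add, add_apply, (h _ _ _).1, (h _ _ _).2.1, (h _ _ _).2.2, add_zero]

/-- The independent variables are transformed conformally, and the components for the dependent
variables do not depend on the independent ones. -/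
theorem fderiv_conformal (hm : 2 ≤ m) (hU : IsOpen U)
    (hQ : Q ∈ maxLieInvarianceAlgebra (reducedSystem F β a c) U) (hb : b ∈ U) (i : Fin m) :
    fderiv ℝ (xiComp Q 1) b (slope 1 0) = fderiv ℝ (xiComp Q 0) b (slope 0 0) ∧
      fderiv ℝ (xiComp Q 1) b (slope 0 0) = -fderiv ℝ (xiComp Q 0) b (slope 1 0) ∧
      ∀ μ, fderiv ℝ (etaComp Q i) b (slope μ 0) = 0 := by
  have hx l g := fderiv_xiComp_vertical hm hU hQ hb l g
  obtain ⟨H, hH⟩ : ∃ H : ℝ, fderiv ℝ (etaComp Q i) b (0, Pi.single i 1) = H := ⟨_, rfl⟩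
  have he g : fderiv ℝ (etaComp Q i) b (0, g) = H * g i := by
    rw [fderiv_etaComp_vertical hU hQ hb i g, hH]
  obtain ⟨A, hA⟩ : ∃ A : Fin 2 → Fin 2 → ℝ, ∀ l μ, fderiv ℝ (xiComp Q l) b (slope μ 0) = A l μ :=
    ⟨_, fun _ _ => rfl⟩
  obtain ⟨B, hB⟩ : ∃ B : Fin 2 → ℝ, ∀ μ, fderiv ℝ (etaComp Q i) b (slope μ 0) = B μ :=
    ⟨_, fun _ => rfl⟩
  have hs l μ g : fderiv ℝ (xiComp Q l) b (slope μ g) = A l μ := by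
    rw [fderiv_xiComp_slope hm hU hQ hb, hA]
  have hs' μ g : fderiv ℝ (etaComp Q i) b (slope μ g) =
      B μ + H * g i := by
    rw [slope_eq, map_add, hB, he]
  have key (x y s₃₀ s₂₁ s₁₂ s₀₃ : ℝ) (hxy : x ^ 2 + y ^ 2 ≠ 0)
      (h : x * (s₂₁ + s₀₃) = y * (s₃₀ + s₁₂)) :=
    criterion_third_order (fun _ => x) (fun _ => y) (fun _ => s₃₀) (fun _ => s₂₁) (fun _ => s₁₂)
      (fun _ => s₀₃) hU hQ hb (fun _ => hxy) (fun _ => h) i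
  simp only [coeff₁, hs, hs', hx, he] at key
  simp only [hA, hB]
  -- Of the four admissible perturbations, the first two give the Cauchy–Riemann equations; the last
  -- two give the vanishing of the derivatives of `η^i` in `z_2` and in `z_1`, respectively.
  have h1 := key 1 0 0 1 0 (-1) (by norm_num) (by norm_num)
  have h2 := key 1 0 (-1) 0 1 0 (by norm_num) (by norm_num)
  have h3 := key 1 0 1 0 0 0 (by norm_num) (by norm_num)
  have h4 := key 0 1 0 0 0 1 (by norm_num) (by norm_num)
  refine ⟨by linarith, by linarith, Fin.forall_fin_two.2 ⟨?_, ?_⟩⟩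
  · linarith
  · linarith

/-! ### Determining equations from the remaining terms. -/

theorem mulVec_const_apply (F : Matrix (Fin m) (Fin m) ℝ) (x : ℝ) (i : Fin m) :
    F.mulVec (fun _ => x) i = x * ∑ k, F i k := by
  simp [Matrix.mulVec, dotProduct, Finset.mul_sum, mul_comm]

/-- The terms of the invariance criterion without third order derivatives of the unknowns. -/
theorem criterion_first_order (hm : 2 ≤ m) (hU : IsOpen U)
    (hQ : Q ∈ maxLieInvarianceAlgebra (reducedSystem F β a c) U) (hb : b ∈ U)
    (g₁ g₂ : Fin m → ℝ) (hg : ∀ k, g₁ k ^ 2 + g₂ k ^ 2 ≠ 0) (i : Fin m) {θ ρ : ℝ} {h : Fin m → ℝ}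
    (hθ : fderiv ℝ (xiComp Q 0) b (slope 0 0) = θ) (hρ : fderiv ℝ (xiComp Q 0) b (slope 1 0) = ρ)
    (hh : ∀ k, fderiv ℝ (etaComp Q k) b (0, Pi.single k 1) = h k) :
    -2 * (h i - 2 * θ) * (F.mulVec c i + a * β)
      - (h i - 2 * θ) * (g₁ i * F.mulVec g₂ i - g₂ i * F.mulVec g₁ i)
      + β * ((3 * θ - h i) * g₁ i + ρ * g₂ i)
      + (g₁ i * F.mulVec (fun k => h k * g₂ k) i - g₂ i * F.mulVec (fun k => h k * g₁ k) i)
      + g₁ i * (coeff₃ b g₁ g₂ Q i (slope 0 g₁) (slope 0 g₁) (slope 1 g₂) +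
        coeff₃ b g₁ g₂ Q i (slope 1 g₂) (slope 1 g₂) (slope 1 g₂))
      - g₂ i * (coeff₃ b g₁ g₂ Q i (slope 0 g₁) (slope 0 g₁) (slope 0 g₁) +
        coeff₃ b g₁ g₂ Q i (slope 0 g₁) (slope 1 g₂) (slope 1 g₂)) = 0 := by
  obtain ⟨s, r, hsr⟩ := exists_third_order (F := F) (β := β) (a := a) (c := c) g₁ g₂ hg
  have h₀ := criterion_thirdJet g₁ g₂ s 0 0 r hU hQ hb (fun k => by simpa using hsr k) i
  have hc k := fderiv_conformal hm hU hQ hb k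
  have hξ₀ g : fderiv ℝ (xiComp Q 0) b (slope 0 g) = θ := by
    rw [fderiv_xiComp_slope hm hU hQ hb, hθ]
  have hξ₁ g : fderiv ℝ (xiComp Q 0) b (slope 1 g) = ρ := by
    rw [fderiv_xiComp_slope hm hU hQ hb, hρ]
  have hξ₂ g : fderiv ℝ (xiComp Q 1) b (slope 0 g) = -ρ := by
    rw [fderiv_xiComp_slope hm hU hQ hb, (hc i).2.1, hρ]
  have hξ₃ g : fderiv ℝ (xiComp Q 1) b (slope 1 g) = θ := by
    rw [fderiv_xiComp_slope hm hU hQ hb, (hc i).1, hθ]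
  have hη k μ g : fderiv ℝ (etaComp Q k) b (slope μ g) = h k * g k := by
    rw [slope_eq, map_add, (hc k).2.2, fderiv_etaComp_vertical hU hQ hb, hh, zero_add]
  have hv g : coeff₁ b g₁ g₂ Q i (0, g) = h i * g i := by
    simp only [coeff₁, fderiv_xiComp_vertical hm hU hQ hb, fderiv_etaComp_vertical hU hQ hb i g, hh]
    ring
  have e₁ : F.mulVec (fun j => coeff₁ b g₁ g₂ Q j (slope 0 g₁)) i =
      F.mulVec (fun k => h k * g₁ k) i - θ * F.mulVec g₁ i + ρ * F.mulVec g₂ i := by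
    simp only [Matrix.mulVec, dotProduct, Finset.mul_sum, ← Finset.sum_sub_distrib,
      ← Finset.sum_add_distrib]
    refine Finset.sum_congr rfl fun k _ => ?_
    simp only [coeff₁, hη, hξ₀, hξ₂]
    ring
  have e₂ : F.mulVec (fun j => coeff₁ b g₁ g₂ Q j (slope 1 g₂)) i =
      F.mulVec (fun k => h k * g₂ k) i - ρ * F.mulVec g₁ i - θ * F.mulVec g₂ i := by
    simp only [Matrix.mulVec, dotProduct, Finset.mul_sum, ← Finset.sum_sub_distrib]
    refine Finset.sum_congr rfl fun k _ => ?_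
    simp only [coeff₁, hη, hξ₁, hξ₃]
    ring
  rw [e₁, e₂] at h₀
  simp only [hv, hξ₀, hξ₁, hξ₂, hξ₃, Pi.zero_apply] at h₀
  simp only [coeff₁, hη, hξ₀, hξ₁, hξ₂, hξ₃] at h₀
  -- Conformality makes the third-order terms a multiple of those of the equation itself, with
  -- factor `2 (h i - 2 θ)`: two factors `v` and four derivatives. The equation therefore eliminates
  -- `s` and `r`.
  linear_combination h₀ - 2 * (h i - 2 * θ) * hsr i

/-- The component `η^i` is locally constant along a slope vector whose `i`-th vertical entry is
zero, so its third derivative contributes nothing. -/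
theorem coeff₃_eq (hm : 2 ≤ m) (hU : IsOpen U)
    (hQ : Q ∈ maxLieInvarianceAlgebra (reducedSystem F β a c) U) (hb : b ∈ U) (i : Fin m)
    (g₁ g₂ f f' f'' : Fin m → ℝ) (κ ν μ : Fin 2) (h : f i = 0 ∨ f'' i = 0) :
    coeff₃ b g₁ g₂ Q i (slope κ f) (slope ν f') (slope μ f'') =
      -(fderiv ℝ (fderiv ℝ (fderiv ℝ (xiComp Q 0))) b (slope κ 0) (slope ν 0) (slope μ 0) * g₁ i +
      fderiv ℝ (fderiv ℝ (fderiv ℝ (xiComp Q 1))) b (slope κ 0) (slope ν 0) (slope μ 0) * g₂ i) := by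
  have hη (κ : Fin 2) (f : Fin m → ℝ) (hf : f i = 0) :
      ∀ b ∈ U, fderiv ℝ (etaComp Q i) b (slope κ f) = 0 := fun b hb => by
    rw [slope_eq, map_add, (fderiv_conformal hm hU hQ hb i).2.2,
      fderiv_etaComp_vertical hU hQ hb, hf, mul_zero, zero_add]
  have h0 : fderiv ℝ (fderiv ℝ (fderiv ℝ (etaComp Q i))) b (slope κ f) (slope ν f')
      (slope μ f'') = 0 := by
    rcases h with h | h
    · exact (fderiv_third_eq_zero hU (contDiffOn_etaComp hQ.1 i) (hη κ f h) hb _ _).2.2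
    · exact (fderiv_third_eq_zero hU (contDiffOn_etaComp hQ.1 i) (hη μ f'' h) hb _ _).1
  rw [coeff₃, h0, fderiv_third_xiComp_slope hm hU hQ hb,
    fderiv_third_xiComp_slope hm hU hQ hb 1]
  ring

/-- For a layer-independent gradient along one axis the coupling terms vanish. The criterion becomes
a quadratic polynomial in the gradient, and its odd part is the `β`-term. -/
theorem infinitesimal_of_uniform_gradient (hm : 2 ≤ m) (hU : IsOpen U) (hβ : 0 < β)
    (hQ : Q ∈ maxLieInvarianceAlgebra (reducedSystem F β a c) U) (hb : b ∈ U) (i : Fin m) :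
    fderiv ℝ (xiComp Q 0) b (slope 1 0) = 0 ∧
      fderiv ℝ (etaComp Q i) b (0, Pi.single i 1) =
        3 * fderiv ℝ (xiComp Q 0) b (slope 0 0) := by
  have hx (x : ℝ) (hx : x ≠ 0) := criterion_first_order hm hU hQ hb (fun _ => x) (fun _ => 0)
    (fun _ => by positivity) i rfl rfl (fun _ => rfl)
  have hy (y : ℝ) (hy : y ≠ 0) := criterion_first_order hm hU hQ hb (fun _ => 0) (fun _ => y)
    (fun _ => by positivity) i rfl rfl (fun _ => rfl)
  simp (disch := simp) only [coeff₃_eq hm hU hQ hb i, mulVec_const_apply, mul_zero] at hx hy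
  have hx1 := hx 1 (by norm_num)
  have hx2 := hx (-1) (by norm_num)
  have hy1 := hy 1 (by norm_num)
  have hy2 := hy (-1) (by norm_num)
  constructor
  · refine (mul_eq_zero.1 (show β * _ = 0 from ?_)).resolve_left hβ.ne'
    -- Half the difference of the values at `1` and `-1` extracts the odd part.
    linear_combination (hy1 - hy2) / 2
  · refine sub_eq_zero.1 ((mul_eq_zero.1 (show β * _ = 0 from ?_)).resolve_left hβ.ne')
    linear_combination (hx2 - hx1) / 2

/-- Layer `j` has gradient `(0, y)` and the other layers `(1, 0)`. In equation `i` only the coupling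
entry `F i j` then brings in `y`, and the part odd in `y` is `F i j (h_j - h_i + 2θ) y`. -/
theorem infinitesimal_of_coupling (hm : 2 ≤ m) (hU : IsOpen U)
    (hQ : Q ∈ maxLieInvarianceAlgebra (reducedSystem F β a c) U) (hb : b ∈ U) {i j : Fin m}
    (hij : i ≠ j) (hF : F i j ≠ 0) :
    fderiv ℝ (etaComp Q j) b (0, Pi.single j 1) =
      fderiv ℝ (etaComp Q i) b (0, Pi.single i 1) -
        2 * fderiv ℝ (xiComp Q 0) b (slope 0 0) := by
  have hy (y : ℝ) (hy : y ≠ 0) := criterion_first_order hm hU hQ hb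
    (fun k => if k = j then 0 else 1) (fun k => if k = j then y else 0)
    (fun k => by by_cases hk : k = j <;> simp [hk, hy]) i rfl rfl (fun _ => rfl)
  have e (y : ℝ) : F.mulVec (fun k => if k = j then y else 0) i = F i j * y := by
    simp [Matrix.mulVec, dotProduct]
  have e' (y : ℝ) (h : Fin m → ℝ) :
      F.mulVec (fun k => h k * if k = j then y else 0) i = F i j * h j * y := by
    simp [Matrix.mulVec, dotProduct, mul_assoc]
  simp (disch := simp [hij]) only [coeff₃_eq hm hU hQ hb i, e, e', if_neg hij, mul_zero,
    zero_mul] at hy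
  have hy1 := hy 1 (by norm_num)
  have hy2 := hy (-1) (by norm_num)
  refine sub_eq_zero.1 ((mul_eq_zero.1 (show F i j * _ = 0 from ?_)).resolve_left hF)
  linear_combination (hy1 - hy2) / 2

theorem couplingMatrix_ne_zero {f : Fin m → Fin m → ℝ} (hf : ∀ i j, Adjacent i j → 0 < f i j)
    {i j : Fin m} (h : Adjacent i j) : couplingMatrix f i j ≠ 0 := by
  simp only [couplingMatrix, Matrix.of_apply, if_pos h]
  exact (hf i j h).ne'

theorem fderiv_eq_zero_of_mem (hm : 2 ≤ m) {f : Fin m → Fin m → ℝ}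
    (hf : ∀ i j, Adjacent i j → 0 < f i j) (hU : IsOpen U) (hβ : 0 < β)
    (hQ : Q ∈ maxLieInvarianceAlgebra (reducedSystem (couplingMatrix f) β a c) U) (hb : b ∈ U) :
    fderiv ℝ Q b = 0 := by
  have hu i := infinitesimal_of_uniform_gradient hm hU hβ hQ hb i
  have hθ : fderiv ℝ (xiComp Q 0) b (slope 0 0) = 0 := by
    -- One pair of neighbouring layers suffices: `h_0 = h_1 = 3θ` together with `h_1 = h_0 - 2θ`
    -- forces `θ = 0`.
    have hadj : Adjacent (⟨0, by omega⟩ : Fin m) ⟨1, by omega⟩ := Or.inl rfl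
    have := infinitesimal_of_coupling hm hU hQ hb (by simp) (couplingMatrix_ne_zero hf hadj)
    rw [(hu _).2, (hu _).2] at this
    linarith
  have hlin (L : Base 2 m →L[ℝ] ℝ) (h0 : L (slope 0 0) = 0) (h1 : L (slope 1 0) = 0)
      (hv : ∀ g, L (0, g) = 0) : L = 0 := by
    refine ContinuousLinearMap.ext fun x => ?_
    have : x = x.1 0 • slope 0 0 + x.1 1 • slope 1 0 + (0, x.2) := by
      ext k
      · fin_cases k <;> simp [slope]
      · simp [slope]
    rw [this]
    simp only [map_add, map_smul, h0, h1, hv]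
    simp
  have i₀ : Fin m := ⟨0, by omega⟩
  have hc i := fderiv_conformal hm hU hQ hb i
  have hv l g := fderiv_xiComp_vertical hm hU hQ hb l g
  have hξ : ∀ l, fderiv ℝ (xiComp Q l) b = 0 := Fin.forall_fin_two.2
    ⟨hlin _ hθ (hu i₀).1 (hv 0),
      hlin _ (by rw [(hc i₀).2.1, (hu i₀).1, neg_zero]) (by rw [(hc i₀).1, hθ]) (hv 1)⟩
  have hη i : fderiv ℝ (etaComp Q i) b = 0 :=
    hlin _ ((hc i).2.2 0) ((hc i).2.2 1) fun g => by
      rw [fderiv_etaComp_vertical hU hQ hb, (hu i).2, hθ]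
      ring
  have hd l := (differentiableAt_of_contDiffOn hU (contDiffOn_xiComp hQ.1 l) b hb).hasFDerivAt
  have hd' i := (differentiableAt_of_contDiffOn hU (contDiffOn_etaComp hQ.1 i) b hb).hasFDerivAt
  have : HasFDerivAt Q (ContinuousLinearMap.prod (ContinuousLinearMap.pi fun l => fderiv ℝ (xiComp Q l) b)
      (ContinuousLinearMap.pi fun i => fderiv ℝ (etaComp Q i) b)) b :=
    (hasFDerivAt_pi.2 hd).prodMk (hasFDerivAt_pi.2 hd')
  rw [this.fderiv]
  ext x k <;> simp [hξ, hη]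

end

section
variable {n m : ℕ}

/-! ### Constant vector fields -/

theorem fderiv_eq_zero_of_eqOn_const {W : Type*} [NormedAddCommGroup W] [NormedSpace ℝ W]
    {U : Set (Base n m)} (hU : IsOpen U) {G : Base n m → W} {w : W} (h : ∀ b ∈ U, G b = w) :
    ∀ b ∈ U, fderiv ℝ G b = 0 := fun b hb => by
  have : G =ᶠ[nhds b] fun _ => w := Filter.eventually_of_mem (hU.mem_nhds hb) h
  rw [this.fderiv_eq]; simp

theorem total_eq_zero_of_eqOn_const {U : Set (Base n m)} (hU : IsOpen U) {g : Base n m → ℝ} {w : ℝ}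
    (h : ∀ b ∈ U, g b = w) {p : Jet n m} (hp : base p ∈ U) (κ ν μ : Fin n) :
    total₁ g μ p = 0 ∧ total₂ g ν μ p = 0 ∧ total₃ g κ ν μ p = 0 := by
  have h1 := fderiv_eq_zero_of_eqOn_const hU h
  have h2 := fderiv_eq_zero_of_eqOn_const hU h1
  have h3 := fderiv_eq_zero_of_eqOn_const hU h2
  simp [total₁, total₂, total₃, h1 _ hp, h2 _ hp, h3 _ hp]

theorem prolong_eq_zero_of_eqOn_const {U : Set (Base n m)} (hU : IsOpen U) {Q : VectorFieldOn n m}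
    {w : Base n m} (h : ∀ b ∈ U, Q b = w) {p : Jet n m} (hp : base p ∈ U) (j : Fin m)
    (κ ν μ : Fin n) : prolong₁ Q j μ p = 0 ∧ prolong₃ Q j κ ν μ p = 0 := by
  have hx (l : Fin n) (κ ν μ : Fin n) := total_eq_zero_of_eqOn_const hU (g := xiComp Q l)
    (w := w.1 l) (fun b hb => by simp [xiComp, h b hb]) hp κ ν μ
  have he (κ ν μ : Fin n) := total_eq_zero_of_eqOn_const hU (g := etaComp Q j)
    (w := w.2 j) (fun b hb => by simp [etaComp, h b hb]) hp κ ν μ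
  constructor
  · simp only [prolong₁, (hx _ κ ν _).1, (he κ ν _).1]
    simp
  · simp only [prolong₃, (hx _ κ ν _).1, (hx _ κ _ _).2.1, (hx _ _ _ _).2.2, (he _ _ _).2.2]
    simp

theorem contDiffOn_of_eqOn_const {U : Set (Base n m)} {Q : VectorFieldOn n m} {w : Base n m}
    (h : ∀ b ∈ U, Q b = w) : ContDiffOn ℝ ∞ Q U :=
  contDiffOn_const.congr h

theorem const_mem_reducedSystem (F : Matrix (Fin m) (Fin m) ℝ) (β a : ℝ) (c : Fin m → ℝ)
    {U : Set (Base 2 m)} (hU : IsOpen U) {Q : VectorFieldOn 2 m} {w : Base 2 m}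
    (h : ∀ b ∈ U, Q b = w) : Q ∈ maxLieInvarianceAlgebra (reducedSystem F β a c) U := by
  have hQ := contDiffOn_of_eqOn_const h
  refine ⟨hQ, fun p hp _ i => ?_⟩
  have h0 j κ ν μ := prolong_eq_zero_of_eqOn_const hU h hp j κ ν μ
  rw [lineDeriv_reducedSystem, prolongation_10 hU hQ i hp, prolongation_01 hU hQ i hp,
    prolongation_21 hU hQ i hp, prolongation_12 hU hQ i hp, prolongation_30 hU hQ i hp,
    prolongation_03 hU hQ i hp, funext fun j => prolongation_10 hU hQ j hp,
    funext fun j => prolongation_01 hU hQ j hp]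
  simp only [(h0 _ 0 0 _).1, (h0 _ _ _ _).2]
  simp [Matrix.mulVec, dotProduct]

theorem const_mem_model (F : Matrix (Fin m) (Fin m) ℝ) (β : ℝ)
    {U : Set (Base 3 m)} (hU : IsOpen U) {Q : VectorFieldOn 3 m} {w : Base 3 m}
    (h : ∀ b ∈ U, Q b = w) : Q ∈ maxLieInvarianceAlgebra (model F β) U := by
  have hQ := contDiffOn_of_eqOn_const h
  refine ⟨hQ, fun p hp _ i => ?_⟩
  have h0 j κ ν μ := prolong_eq_zero_of_eqOn_const hU h hp j κ ν μ
  have h1 (j : Fin m) {α : Fin 3 → ℕ} (μ : Fin 3) (hα : α = unitIndex μ)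
      (hA : ∀ A : Jet 3 m → ℝ, totalDerivs α A = totalDeriv μ A) :
      (prolongation Q p).2 j α = 0 :=
    (prolongation_of_totalDerivs_eq₁ hU hQ hα hA hp).trans (h0 j 0 0 μ).1
  have h3 (j : Fin m) {α : Fin 3 → ℕ} (κ ν μ : Fin 3)
      (hα : α = unitIndex μ + unitIndex ν + unitIndex κ)
      (hA : ∀ A : Jet 3 m → ℝ, totalDerivs α A = totalDeriv κ (totalDeriv ν (totalDeriv μ A))) :
      (prolongation Q p).2 j α = 0 :=
    (prolongation_of_totalDerivs_eq₃ hU hQ hα hA hp).trans (h0 j κ ν μ).2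
  -- The model involves only the nine listed derivative coordinates, and on these the prolongation
  -- of a constant field is zero.
  rw [lineDeriv_model_congr F β i p _ 0, lineDeriv_zero]
  rintro j α (rfl | rfl | rfl | rfl | rfl | rfl | rfl | rfl | rfl)
  · exact h1 j 0 (by decide) fun _ => rfl
  · exact h1 j 1 (by decide) fun _ => rfl
  · exact h1 j 2 (by decide) fun _ => rfl
  · exact h3 j 0 1 1 (by decide) fun _ => rfl
  · exact h3 j 0 2 2 (by decide) fun _ => rfl
  · exact h3 j 1 1 1 (by decide) fun _ => rfl
  · exact h3 j 1 1 2 (by decide) fun _ => rfl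
  · exact h3 j 1 2 2 (by decide) fun _ => rfl
  · exact h3 j 2 2 2 (by decide) fun _ => rfl

/-- The span of the coordinate vector fields consists of the constant vector fields. -/
theorem mem_span_iff_const (X : VectorFieldOn 2 m) :
    X ∈ Submodule.span ℝ (({partialX 0, partialX 1} : Set (VectorFieldOn 2 m)) ∪
      Set.range partialU) ↔ ∃ w, X = fun _ => w := by
  constructor
  · intro h
    induction h using Submodule.span_induction with
    | mem x hx =>
      rcases hx with (rfl | rfl) | ⟨j, rfl⟩
      exacts [⟨_, rfl⟩, ⟨_, rfl⟩, ⟨_, rfl⟩]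
    | zero => exact ⟨0, rfl⟩
    | add x y _ _ hx hy =>
      obtain ⟨v, rfl⟩ := hx
      obtain ⟨w, rfl⟩ := hy
      exact ⟨v + w, rfl⟩
    | smul r x _ hx =>
      obtain ⟨v, rfl⟩ := hx
      exact ⟨r • v, rfl⟩
  · rintro ⟨w, rfl⟩
    have : (fun _ => w : VectorFieldOn 2 m) =
        w.1 0 • partialX 0 + w.1 1 • partialX 1 + ∑ j, w.2 j • partialU j := by
      funext b
      ext k
      · fin_cases k <;> simp [partialX, partialU, Prod.fst_sum]
      · simp [partialX, partialU, Prod.snd_sum, Finset.sum_apply, Pi.single_apply]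
    rw [this]
    refine add_mem (add_mem ?_ ?_) (sum_mem fun j _ => ?_)
    · exact Submodule.smul_mem _ _ (Submodule.subset_span (by simp))
    · exact Submodule.smul_mem _ _ (Submodule.subset_span (by simp))
    · exact Submodule.smul_mem _ _ (Submodule.subset_span (by simp))

/-! ### Lifting jets by the ansatz -/

/-- The jet of `ψ^i = v^i(x, y - a t) + c_i t + a x` at the time `t`, given the jet of `v`. -/
def liftJet (a : ℝ) (c : Fin m → ℝ) (p : Jet 2 m) (t : ℝ) : Jet 3 m :=
  (![t, p.1 0, p.1 1 + a * t], fun j α => (-a) ^ α 0 * p.2 j ![α 1, α 0 + α 2] +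
    c j * (if α = 0 then t else if α = unitIndex 0 then 1 else 0) +
    a * (if α = 0 then p.1 0 else if α = unitIndex 1 then 1 else 0))

/-- The linear part of `liftJet`. -/
def liftVec (a : ℝ) (c : Fin m → ℝ) (V : Jet 2 m) (τ : ℝ) : Jet 3 m :=
  (![τ, V.1 0, V.1 1 + a * τ], fun j α => (-a) ^ α 0 * V.2 j ![α 1, α 0 + α 2] +
    if α = 0 then c j * τ + a * V.1 0 else 0)

variable (a : ℝ) (c : Fin m → ℝ)

theorem liftJet_add_smul (p V : Jet 2 m) (t τ s : ℝ) :
    liftJet a c (p + s • V) (t + s * τ) = liftJet a c p t + s • liftVec a c V τ := by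
  refine Prod.ext ?_ ?_
  · ext k
    fin_cases k <;> simp [liftJet, liftVec]; ring
  · ext j α
    by_cases h : α = 0
    · simp [liftJet, liftVec, h]; ring
    · simp [liftJet, liftVec, h]; ring

/-- On functions of `x` and `y - a t`, differentiation in `t` acts as `-a ∂_{z_2}`. The value `τ =
1` moves the time and so accounts for the summand `c t`. -/
theorem totalVec_zero_liftJet (p : Jet 2 m) (t : ℝ) :
    totalVec 0 (liftJet a c p t) = liftVec a c (-a • totalVec 1 p) 1 := by
  refine Prod.ext ?_ ?_
  · ext k
    fin_cases k <;> simp [liftVec, totalVec]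
  · ext j α
    have e : ![(α + unitIndex 0 : Fin 3 → ℕ) 1,
        (α + unitIndex 0 : Fin 3 → ℕ) 0 + (α + unitIndex 0 : Fin 3 → ℕ) 2] =
        ![α 1, α 0 + α 2] + unitIndex (1 : Fin 2) := by
      ext k; fin_cases k <;> simp; ring
    have e0 : (α + unitIndex 0 : Fin 3 → ℕ) 0 = α 0 + 1 := by simp
    have e1 : α + unitIndex 0 ≠ 0 := fun h => by simpa using congrFun h 0
    have e2 : α + unitIndex 0 ≠ unitIndex 1 := fun h => by simpa using congrFun h 0
    have e3 : α + unitIndex 0 = unitIndex 0 ↔ α = 0 := by simp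
    simp only [liftJet, liftVec, totalVec, if_neg e1, if_neg e2, e3, e,
      Prod.smul_fst, Prod.smul_snd, Pi.smul_apply, smul_eq_mul, Pi.single_eq_of_ne zero_ne_one]
    rw [e0, pow_succ]
    split_ifs <;> ring

theorem totalVec_one_liftJet (p : Jet 2 m) (t : ℝ) :
    totalVec 1 (liftJet a c p t) = liftVec a c (totalVec 0 p) 0 := by
  refine Prod.ext ?_ ?_
  · ext k
    fin_cases k <;> simp [liftVec, totalVec]
  · ext j α
    have e : ![(α + unitIndex 1 : Fin 3 → ℕ) 1,
        (α + unitIndex 1 : Fin 3 → ℕ) 0 + (α + unitIndex 1 : Fin 3 → ℕ) 2] =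
        ![α 1, α 0 + α 2] + unitIndex (0 : Fin 2) := by
      ext k; fin_cases k <;> simp
    have e0 : (α + unitIndex 1 : Fin 3 → ℕ) 0 = α 0 := by simp
    have e1 : α + unitIndex 1 ≠ 0 := fun h => by simpa using congrFun h 1
    have e2 : α + unitIndex 1 ≠ unitIndex 0 := fun h => by simpa using congrFun h 1
    have e3 : α + unitIndex 1 = unitIndex 1 ↔ α = 0 := by simp
    simp only [liftJet, liftVec, totalVec, if_neg e1, if_neg e2, e3, e, Pi.single_eq_same]
    rw [e0]
    split_ifs <;> ring

theorem totalVec_two_liftJet (p : Jet 2 m) (t : ℝ) :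
    totalVec 2 (liftJet a c p t) = liftVec a c (totalVec 1 p) 0 := by
  refine Prod.ext ?_ ?_
  · ext k
    fin_cases k <;> simp [liftVec, totalVec]
  · ext j α
    have e : ![(α + unitIndex 2 : Fin 3 → ℕ) 1,
        (α + unitIndex 2 : Fin 3 → ℕ) 0 + (α + unitIndex 2 : Fin 3 → ℕ) 2] =
        ![α 1, α 0 + α 2] + unitIndex (1 : Fin 2) := by
      ext k; fin_cases k <;> simp; ring
    have e0 : (α + unitIndex 2 : Fin 3 → ℕ) 0 = α 0 := by simp
    have e1 : α + unitIndex 2 ≠ 0 := fun h => by simpa using congrFun h 2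
    have e2 : α + unitIndex 2 ≠ unitIndex 0 := fun h => by simpa using congrFun h 2
    have e3 : α + unitIndex 2 ≠ unitIndex 1 := fun h => by simpa using congrFun h 2
    simp only [liftJet, liftVec, totalVec, if_neg e1, if_neg e2, if_neg e3, e,
      Pi.single_eq_of_ne zero_ne_one]
    rw [e0]
    split_ifs <;> ring

theorem invariants_base_liftJet (p : Jet 2 m) (t : ℝ) :
    invariants a c (base (liftJet a c p t)) = base p := by
  refine Prod.ext ?_ ?_
  · ext k
    fin_cases k <;> simp [liftJet, invariants, base]
  · ext j
    simp [liftJet, invariants, base, show (![0, 0] : Fin 2 → ℕ) = 0 by decide]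
    ring

variable {a c} {U : Set (Base 2 m)}

/-- Since the lift is affine, it sends lines to lines, and the two difference quotients agree near
zero. -/
theorem lineDeriv_liftJet (hU : IsOpen U) {A : Jet 3 m → ℝ} {B : Jet 2 m → ℝ}
    (h : ∀ p t, base p ∈ U → A (liftJet a c p t) = B p) {p : Jet 2 m} (hp : base p ∈ U)
    (t : ℝ) (V : Jet 2 m) (τ : ℝ) :
    lineDeriv ℝ A (liftJet a c p t) (liftVec a c V τ) = lineDeriv ℝ B p V := by
  refine Filter.EventuallyEq.deriv_eq ((eventually_base_mem hU hp V).mono fun s hs => ?_)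
  simp only [← liftJet_add_smul]
  exact h _ _ hs

theorem totalDeriv_zero_liftJet (hU : IsOpen U) {A : Jet 3 m → ℝ} {B : Jet 2 m → ℝ}
    (h : ∀ p t, base p ∈ U → A (liftJet a c p t) = B p) (p : Jet 2 m) (t : ℝ)
    (hp : base p ∈ U) : totalDeriv 0 A (liftJet a c p t) = -a * totalDeriv 1 B p := by
  have := lineDeriv_liftJet hU h hp t (-a • totalVec 1 p) 1
  rw [← totalVec_zero_liftJet, lineDeriv_smul] at this
  exact this

theorem totalDeriv_one_liftJet (hU : IsOpen U) {A : Jet 3 m → ℝ} {B : Jet 2 m → ℝ}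
    (h : ∀ p t, base p ∈ U → A (liftJet a c p t) = B p) (p : Jet 2 m) (t : ℝ)
    (hp : base p ∈ U) : totalDeriv 1 A (liftJet a c p t) = totalDeriv 0 B p := by
  have := lineDeriv_liftJet hU h hp t (totalVec 0 p) 0
  rw [← totalVec_one_liftJet] at this
  exact this

theorem totalDeriv_two_liftJet (hU : IsOpen U) {A : Jet 3 m → ℝ} {B : Jet 2 m → ℝ}
    (h : ∀ p t, base p ∈ U → A (liftJet a c p t) = B p) (p : Jet 2 m) (t : ℝ)
    (hp : base p ∈ U) : totalDeriv 2 A (liftJet a c p t) = totalDeriv 1 B p := by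
  have := lineDeriv_liftJet hU h hp t (totalVec 1 p) 0
  rw [← totalVec_two_liftJet] at this
  exact this

theorem liftJet_apply (p : Jet 2 m) (t : ℝ) (j : Fin m) {α : Fin 3 → ℕ} (h : α ≠ 0)
    (h₀ : α ≠ unitIndex 0) (h₁ : α ≠ unitIndex 1) :
    (liftJet a c p t).2 j α = (-a) ^ α 0 * p.2 j ![α 1, α 0 + α 2] := by
  simp [liftJet, h, h₀, h₁]

theorem liftJet_100 (p : Jet 2 m) (t : ℝ) (j : Fin m) :
    (liftJet a c p t).2 j ![1, 0, 0] = -a * p.2 j ![0, 1] + c j := by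
  simp only [liftJet, if_neg (show (![1, 0, 0] : Fin 3 → ℕ) ≠ 0 by decide),
    if_pos (show (![1, 0, 0] : Fin 3 → ℕ) = unitIndex 0 by decide),
    if_neg (show (![1, 0, 0] : Fin 3 → ℕ) ≠ unitIndex 1 by decide)]
  simp

theorem liftJet_010 (p : Jet 2 m) (t : ℝ) (j : Fin m) :
    (liftJet a c p t).2 j ![0, 1, 0] = p.2 j ![1, 0] + a := by
  simp only [liftJet, if_neg (show (![0, 1, 0] : Fin 3 → ℕ) ≠ 0 by decide),
    if_neg (show (![0, 1, 0] : Fin 3 → ℕ) ≠ unitIndex 0 by decide),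
    if_pos (show (![0, 1, 0] : Fin 3 → ℕ) = unitIndex 1 by decide)]
  simp

/-- The summand `a x` of the ansatz adds `a` to `ψ_x`. This cancels the drift `-a` from the time
derivative and leaves `a β`; zero row sums remove `a x` from the coupling, and `c t` contributes `F
c`. -/
theorem model_liftJet {F : Matrix (Fin m) (Fin m) ℝ} (hF : ∀ i, ∑ j, F i j = 0) (β : ℝ)
    (i : Fin m) (p : Jet 2 m) (t : ℝ) :
    model F β i (liftJet a c p t) = reducedSystem F β a c i p := by
  have h120 : (liftJet a c p t).2 i ![1, 2, 0] = (-a) ^ 1 * p.2 i ![2, 1] :=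
    liftJet_apply p t i (by decide) (by decide) (by decide)
  have h102 : (liftJet a c p t).2 i ![1, 0, 2] = (-a) ^ 1 * p.2 i ![0, 3] :=
    liftJet_apply p t i (by decide) (by decide) (by decide)
  have h021 : (liftJet a c p t).2 i ![0, 2, 1] = (-a) ^ 0 * p.2 i ![2, 1] :=
    liftJet_apply p t i (by decide) (by decide) (by decide)
  have h003 : (liftJet a c p t).2 i ![0, 0, 3] = (-a) ^ 0 * p.2 i ![0, 3] :=
    liftJet_apply p t i (by decide) (by decide) (by decide)
  have h030 : (liftJet a c p t).2 i ![0, 3, 0] = (-a) ^ 0 * p.2 i ![3, 0] :=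
    liftJet_apply p t i (by decide) (by decide) (by decide)
  have h012 : (liftJet a c p t).2 i ![0, 1, 2] = (-a) ^ 0 * p.2 i ![1, 2] :=
    liftJet_apply p t i (by decide) (by decide) (by decide)
  have h001 (j : Fin m) : (liftJet a c p t).2 j ![0, 0, 1] = (-a) ^ 0 * p.2 j ![0, 1] :=
    liftJet_apply p t j (by decide) (by decide) (by decide)
  have e₀ : (F.mulVec fun j => (liftJet a c p t).2 j ![1, 0, 0]) i =
      -a * (F.mulVec fun j => p.2 j ![0, 1]) i + F.mulVec c i := by
    simp only [liftJet_100, Matrix.mulVec, dotProduct, Finset.mul_sum, ← Finset.sum_add_distrib]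
    exact Finset.sum_congr rfl fun k _ => by ring
  have e₁ : (F.mulVec fun j => (liftJet a c p t).2 j ![0, 1, 0]) i =
      (F.mulVec fun j => p.2 j ![1, 0]) i := by
    simp only [liftJet_010, Matrix.mulVec, dotProduct, mul_add, Finset.sum_add_distrib,
      ← Finset.sum_mul, hF]
    ring
  have e₂ : (F.mulVec fun j => (liftJet a c p t).2 j ![0, 0, 1]) i =
      (F.mulVec fun j => p.2 j ![0, 1]) i := by
    simp only [h001, pow_zero, one_mul]
  rw [model_apply, reducedSystem_apply, e₀, e₁, e₂, h120, h102, h021, h003, h030, h012, h001,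
    liftJet_010]
  ring

theorem couplingMatrix_row_sum (f : Fin m → Fin m → ℝ) (i : Fin m) :
    ∑ j, couplingMatrix f i j = 0 := by
  have h (j : Fin m) : couplingMatrix f i j = (if Adjacent i j then f i j else 0) +
      if i = j then -∑ k, (if Adjacent i k then f i k else 0) else 0 := by
    rcases eq_or_ne i j with rfl | hij
    · simp [couplingMatrix]
    · simp [couplingMatrix, hij]
  simp [h, Finset.sum_add_distrib]

/-! ### Induced vector fields -/

/-- The invariants as a linear map. -/
def invariantsLinear (a : ℝ) (c : Fin m → ℝ) : Base 3 m →ₗ[ℝ] Base 2 m where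
  toFun := invariants a c
  map_add' P P' := by
    refine Prod.ext ?_ ?_
    · ext k; fin_cases k <;> simp [invariants]; ring
    · ext k; simp [invariants]; ring
  map_smul' r P := by
    refine Prod.ext ?_ ?_
    · ext k; fin_cases k <;> simp [invariants]; ring
    · ext k; simp [invariants]; ring

/-- A linear section of the invariants. -/
def invariantsSection (a : ℝ) : Base 2 m →ₗ[ℝ] Base 3 m where
  toFun b := (![0, b.1 0, b.1 1], fun i => b.2 i + a * b.1 0)
  map_add' P P' := by
    refine Prod.ext ?_ ?_
    · ext k; fin_cases k <;> simp
    · ext k; simp; ring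
  map_smul' r P := by
    refine Prod.ext ?_ ?_
    · ext k; fin_cases k <;> simp
    · ext k; simp; ring

theorem invariants_section (b : Base 2 m) : invariants a c (invariantsSection a b) = b := by
  refine Prod.ext ?_ ?_
  · ext k; fin_cases k <;> simp [invariants, invariantsSection]
  · ext k; simp [invariants, invariantsSection]

theorem contDiff_invariants : ContDiff ℝ ∞ (invariants a c) :=
  (invariantsLinear a c).toContinuousLinearMap.contDiff

theorem fderiv_invariants (P x : Base 3 m) :
    fderiv ℝ (invariants a c) P x = invariants a c x := by
  have := (invariantsLinear a c).toContinuousLinearMap.hasFDerivAt (x := P)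
  exact congrArg (fun L => L x) (HasFDerivAt.fderiv this)

variable {Q : VectorFieldOn 3 m} {R : VectorFieldOn 2 m}

theorem contDiffOn_of_induced (hQ : ContDiffOn ℝ ∞ Q (invariants a c ⁻¹' U))
    (hR : ∀ P ∈ invariants a c ⁻¹' U, invariants a c (Q P) = R (invariants a c P)) :
    ContDiffOn ℝ ∞ R U := by
  have hs : ContDiff ℝ ∞ (invariantsSection (m := m) a) :=
    (invariantsSection (m := m) a).toContinuousLinearMap.contDiff
  have hmaps : Set.MapsTo (invariantsSection a) U (invariants a c ⁻¹' U) := fun b hb => by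
    simpa [invariants_section] using hb
  refine ((contDiff_invariants (a := a) (c := c)).comp_contDiffOn
    (hQ.comp hs.contDiffOn hmaps)).congr fun b hb => ?_
  simp only [Function.comp_apply]
  rw [hR _ (hmaps hb), invariants_section]

/-- The characteristic measures the infinitesimal change of a graph, which for graphs of the form of
the ansatz depends only on the induced field. -/
theorem characteristic_liftJet
    (hR : ∀ P ∈ invariants a c ⁻¹' U, invariants a c (Q P) = R (invariants a c P)) (j : Fin m)
    (p : Jet 2 m) (t : ℝ) (hp : base p ∈ U) :
    characteristic Q j (liftJet a c p t) = characteristic R j p := by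
  have h := hR (base (liftJet a c p t)) (by simpa [invariants_base_liftJet] using hp)
  rw [invariants_base_liftJet] at h
  have h0 : (liftJet a c p t).2 j (unitIndex 0) = -a * p.2 j (unitIndex 1) + c j := by
    rw [show (unitIndex 0 : Fin 3 → ℕ) = ![1, 0, 0] by decide, liftJet_100,
      show (unitIndex 1 : Fin 2 → ℕ) = ![0, 1] by decide]
  have h1 : (liftJet a c p t).2 j (unitIndex 1) = p.2 j (unitIndex 0) + a := by
    rw [show (unitIndex 1 : Fin 3 → ℕ) = ![0, 1, 0] by decide, liftJet_010,
      show (unitIndex 0 : Fin 2 → ℕ) = ![1, 0] by decide]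
  have h2 : (liftJet a c p t).2 j (unitIndex 2) = p.2 j (unitIndex 1) := by
    rw [liftJet_apply p t j (by decide) (by decide) (by decide),
      show (unitIndex 1 : Fin 2 → ℕ) = ![0, 1] by decide]
    simp
  simp only [characteristic, Fin.sum_univ_three, Fin.sum_univ_two, h0, h1, h2, ← h]
  simp only [invariants, Matrix.cons_val_zero, Matrix.cons_val_one]
  ring

/-- The `ξ`-corrections match through the three `totalVec` identities; what is left is the
comparison of the differentiated characteristics, taken as hypothesis `h`. -/
theorem prolongation_liftJet
    (hR : ∀ P ∈ invariants a c ⁻¹' U, invariants a c (Q P) = R (invariants a c P)) (j : Fin m)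
    (p : Jet 2 m) (t : ℝ) (hp : base p ∈ U) {α : Fin 3 → ℕ} (hα : α ≠ 0)
    (h : totalDerivs α (characteristic Q j) (liftJet a c p t) =
      (-a) ^ α 0 * totalDerivs ![α 1, α 0 + α 2] (characteristic R j) p) :
    (prolongation Q (liftJet a c p t)).2 j α =
      (liftVec a c (prolongation R p) ((Q (base (liftJet a c p t))).1 0)).2 j α := by
  have hb := hR (base (liftJet a c p t)) (by simpa [invariants_base_liftJet] using hp)
  rw [invariants_base_liftJet] at hb
  have h0 : (liftJet a c p t).2 j (α + unitIndex 0) = _ :=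
    congrArg (fun V : Jet 3 m => V.2 j α) (totalVec_zero_liftJet a c p t)
  have h1 : (liftJet a c p t).2 j (α + unitIndex 1) = _ :=
    congrArg (fun V : Jet 3 m => V.2 j α) (totalVec_one_liftJet a c p t)
  have h2 : (liftJet a c p t).2 j (α + unitIndex 2) = _ :=
    congrArg (fun V : Jet 3 m => V.2 j α) (totalVec_two_liftJet a c p t)
  simp only [prolongation, liftVec, if_neg hα, Fin.sum_univ_three, Fin.sum_univ_two, h, h0, h1, h2,
    ← hb]
  simp only [invariants, totalVec, Matrix.cons_val_zero, Matrix.cons_val_one, Prod.smul_snd,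
    Pi.smul_apply, smul_eq_mul]
  ring

/-- A vector field induced by a symmetry of the model is a symmetry of the reduced system. -/
theorem induced_mem_reducedSystem {F : Matrix (Fin m) (Fin m) ℝ} (hF : ∀ i, ∑ j, F i j = 0)
    (β : ℝ) (hU : IsOpen U)
    (hQ : Q ∈ maxLieInvarianceAlgebra (model F β) (invariants a c ⁻¹' U))
    (hR : ∀ P ∈ invariants a c ⁻¹' U, invariants a c (Q P) = R (invariants a c P)) :
    R ∈ maxLieInvarianceAlgebra (reducedSystem F β a c) U := by
  have hRs := contDiffOn_of_induced hQ.1 hR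
  refine ⟨hRs, fun p hp hE i => ?_⟩
  have hχ (j : Fin m) := characteristic_liftJet hR j
  have hχ1 (j : Fin m) := totalDeriv_one_liftJet hU (hχ j)
  have hχ2 (j : Fin m) := totalDeriv_two_liftJet hU (hχ j)
  have hχ11 (j : Fin m) := totalDeriv_one_liftJet hU (hχ1 j)
  have hχ12 (j : Fin m) := totalDeriv_one_liftJet hU (hχ2 j)
  have hχ22 (j : Fin m) := totalDeriv_two_liftJet hU (hχ2 j)
  have h := hQ.2 (liftJet a c p 0) (by simpa [invariants_base_liftJet] using hp)
    (fun k => by rw [model_liftJet hF, hE k]) i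
  rw [lineDeriv_model_congr F β i _ _
    (liftVec a c (prolongation R p) ((Q (base (liftJet a c p 0))).1 0)),
    lineDeriv_liftJet hU (fun p t _ => model_liftJet hF β i p t) hp] at h
  · exact h
  · rintro j α (rfl | rfl | rfl | rfl | rfl | rfl | rfl | rfl | rfl)
    · refine prolongation_liftJet hR j p 0 hp (by decide) ?_
      refine (totalDeriv_zero_liftJet hU (hχ j) p 0 hp).trans ?_
      exact congrArg (· * _) (pow_one (-a)).symm
    · refine prolongation_liftJet hR j p 0 hp (by decide) ?_
      exact (hχ1 j p 0 hp).trans (one_mul _).symm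
    · refine prolongation_liftJet hR j p 0 hp (by decide) ?_
      exact (hχ2 j p 0 hp).trans (one_mul _).symm
    · refine prolongation_liftJet hR j p 0 hp (by decide) ?_
      refine (totalDeriv_zero_liftJet hU (hχ11 j) p 0 hp).trans ?_
      -- The lift produces `D_1 D_0 D_0`, whereas `totalDerivs` applies `D_1` first.
      rw [totalDeriv_rotate hU hRs j 1 0 hp]
      exact congrArg (· * _) (pow_one (-a)).symm
    · refine prolongation_liftJet hR j p 0 hp (by decide) ?_
      refine (totalDeriv_zero_liftJet hU (hχ22 j) p 0 hp).trans ?_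
      exact congrArg (· * _) (pow_one (-a)).symm
    · refine prolongation_liftJet hR j p 0 hp (by decide) ?_
      exact (totalDeriv_one_liftJet hU (hχ11 j) p 0 hp).trans (one_mul _).symm
    · refine prolongation_liftJet hR j p 0 hp (by decide) ?_
      exact (totalDeriv_one_liftJet hU (hχ12 j) p 0 hp).trans (one_mul _).symm
    · refine prolongation_liftJet hR j p 0 hp (by decide) ?_
      exact (totalDeriv_one_liftJet hU (hχ22 j) p 0 hp).trans (one_mul _).symm
    · refine prolongation_liftJet hR j p 0 hp (by decide) ?_
      exact (totalDeriv_two_liftJet hU (hχ22 j) p 0 hp).trans (one_mul _).symm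

/-- Every constant vector field is induced by a constant vector field. -/
theorem const_mem_inducedAlgebra (F : Matrix (Fin m) (Fin m) ℝ) (β : ℝ) (hU : IsOpen U)
    {w : Base 2 m} (h : ∀ b ∈ U, R b = w) : R ∈ inducedAlgebra F β a c U := by
  -- A linear section of the invariants gives a constant preimage, whose bracket with the constant
  -- generator is zero.
  refine ⟨fun _ => invariantsSection a w, ⟨const_mem_model F β
    (hU.preimage contDiff_invariants.continuous) (fun _ _ => rfl), fun S hS => ?_⟩, fun P hP => ?_⟩
  · obtain ⟨r, rfl⟩ := Submodule.mem_span_singleton.1 hS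
    refine ⟨0, zero_mem _, fun P _ => ?_⟩
    have : r • generator a c = fun _ : Base 3 m => (r • generator a c) 0 := by
      funext P
      simp [generator, partialX, partialU]
    rw [this, VectorField.lieBracket]
    simp
  · rw [fderiv_invariants, invariants_section, h _ hP]

end

end QG

end


/-! ### The two descriptions of the algebra. -/

theorem mainTheorem9 {m : ℕ} (hm : 2 ≤ m)
    (f : Fin m → Fin m → ℝ) (hf : ∀ i j, QG.Adjacent i j → 0 < f i j)
    (β : ℝ) (hβ : 0 < β) (a : ℝ) (c : Fin m → ℝ)
    (hc : c ∈ Set.range (QG.couplingMatrix f).mulVec)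
    (U : Set (QG.Base 2 m)) (hUo : IsOpen U) (hUc : IsConnected U) :
    QG.maxLieInvarianceAlgebra (QG.reducedSystem (QG.couplingMatrix f) β a c) U =
        {Q | ∃ X ∈ Submodule.span ℝ
            (({QG.partialX 0, QG.partialX 1} : Set (QG.VectorFieldOn 2 m)) ∪
              Set.range QG.partialU), Set.EqOn Q X U} ∧
      QG.maxLieInvarianceAlgebra (QG.reducedSystem (QG.couplingMatrix f) β a c) U =
        QG.inducedAlgebra (QG.couplingMatrix f) β a c U := by
  have hconst : ∀ Q ∈ QG.maxLieInvarianceAlgebra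
      (QG.reducedSystem (QG.couplingMatrix f) β a c) U, ∃ w, ∀ b ∈ U, Q b = w := fun Q hQ =>
    hUo.exists_is_const_of_fderiv_eq_zero hUc.isPreconnected
      (hQ.1.differentiableOn (by simp))
      fun b hb => QG.fderiv_eq_zero_of_mem hm hf hUo hβ hQ hb
  refine ⟨Set.Subset.antisymm ?_ ?_, Set.Subset.antisymm ?_ ?_⟩
  · intro Q hQ
    obtain ⟨w, hw⟩ := hconst Q hQ
    exact ⟨fun _ => w, (QG.mem_span_iff_const _).2 ⟨w, rfl⟩, hw⟩
  · rintro Q ⟨X, hX, hQX⟩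
    obtain ⟨w, rfl⟩ := (QG.mem_span_iff_const X).1 hX
    exact QG.const_mem_reducedSystem _ β a c hUo hQX
  · intro Q hQ
    obtain ⟨w, hw⟩ := hconst Q hQ
    exact QG.const_mem_inducedAlgebra _ β hUo hw
  -- Projectability onto the invariants, recorded in `hR`, is all that the lifting argument needs
  -- besides invariance of the model.
  · rintro R ⟨Q, hQ, hR⟩
    exact QG.induced_mem_reducedSystem (QG.couplingMatrix_row_sum f) β hUo hQ.1
      fun P hP => by rw [← QG.fderiv_invariants P, hR P hP]
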